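/- **Setting.** Let $L_{all}$ be the language with a name for every function and every relation on $\mathbb N$, let $\mathcal M$ be an $\aleph_1$-saturated model of the complete $L_{all}$-theory of $\mathbb N$, and let $n\in\mathcal M$ be a nonstandard number that is a power of two. Standard sequences of finite objects are identified with sequences of codes, so that they have terms with index $n$. "Coded" means coded by an element of $\mathcal M$, and $|x|$ is the bit length of a number $x$. - *Samples.* For $k\ge 1$, $M_{k,\lfloor k/2\rfloor}$ is the set of graphs of maps $\{0,\dots,k-1\}\to\{0,\dots,\lfloor k/2\rfloor-1\}$; the sample space is $\Omega=M_{n,\lfloor n/2\rfloor}$, and $E_\omega$ is the edge relation of $\omega\in\Omega$. - *Truth values.* $\mathcal A$ is the Boolean algebra of coded subsets of $\Omega$, $\mathcal I$ is the ideal of those $A\in\mathcal A$ with $|A|/|\Omega|$ infinitesimal, and $\mathcal B=\mathcal A/\mathcal I$, with least element $\mathbf 0$. - *Numbers.* $\mathcal M_n$ is the set of $x\in\mathcal M$ with $x\le 2^{n^{1/t}}$ for some nonstandard $t$ (here and below $n^{1/t}$ is rounded to the nearest element of $\mathcal M$). $L_n$ consists of all relation symbols of $L_{all}$ and of the function symbols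 under which $\mathcal M_n$ is closed. - *$F_{nb}$* is the set of functions on $\Omega$ computed by coded trees of depth at most $n^{1/t}$ for some nonstandard $t$, in which each inner node is labeled by some $v<n$ and has one outgoing edge for each $u<n$, and each leaf is labeled by an element of $\mathcal M_n$; on $\omega$ one leaves a node labeled $v$ along the edge labeled by the image of $v$ in $\omega$, and the output is the label of the leaf reached. - *$G_{nb}$* is a set of random functions. A $k$-ary random function is a coded assignment $\Theta$, to each $\omega\in\Omega$, of a partial function $\Theta_\omega$ from $\mathcal M_n^k$ to $\mathcal M_n$; put $\Theta(\alpha_1,\dots,\alpha_k)(\omega)=\Theta_\omega(\alpha_1(\omega),\dots,\alpha_k(\omega))$, or $0$ outside the domain of $\Theta_\omega$. A unary $\Theta$ is in $G_{nb}$ if there is a coded tuple $(\gamma_0,\dots,\gamma_{m-1})$ of elements of $F_{nb}$ such that, for all $\alpha\in F_{nb}$ and $\omega\in\Omega$, $\Theta(\alpha)(\omega)=\gamma_{\alpha(\omega)}(\omega)$ if $\alpha(\omega)<m$, and $\Theta(\alpha)(\omega)=0$ otherwise. For $k>1$, a $k$-ary $\Theta$ is in $G_{nb}$ if $\Theta(\alpha_1,\dots,\alpha_k)=\Theta'(\alpha_1,\dots,\alpha_{k-2},\langle\alpha_{k-1},\alpha_k\rangle)$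 on $F_{nb}$ for some $(k-1)$-ary $\Theta'\in G_{nb}$, where $\langle\cdot,\cdot\rangle$ is the pairing function. - *$K=K(M_{n,\lfloor n/2\rfloor},F_{nb},G_{nb})$* is the $\mathcal B$-valued structure for two-sorted formulas over $L_n$ whose number sort is $F_{nb}$ and whose set sort is $G_{nb}$ (set variables of arity $k$ are used as $k$-ary function symbols and range over the $k$-ary elements of $G_{nb}$). An atomic formula has as its value the class in $\mathcal B$ of the set of $\omega$ at which it holds; connectives and quantifiers are interpreted by the Boolean operations and by suprema and infima in $\mathcal B$. - *The wide limit* $\lim_{F_{nb}}M_{n,\lfloor n/2\rfloor}$ is the $\mathcal B$-valued $\{E\}$-structure whose universe consists of the $\alpha\in F_{nb}$ with all values below $n$, with $[\![E(\alpha,\beta)]\!]=\{\omega: E_\omega(\alpha(\omega),\beta(\omega))\}/\mathcal I$. Let $\varphi(X,m,x_1,x_2)$ be the formula $$m=0\ \lor\ \Big(|x_1|<|m|\ \land\ |x_2|<|m|\ \land\ \big(|X(x_1)|\ge|m|-1\ \lor\ |X(x_2)|\ge|m|-1\ \lor\ (x_1\ne x_2\land X(x_1)=X(x_2))\big)\Big),$$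 which says that $x_1,x_2$ is a solution of the WeakPigeon instance $(X,m)$. **Theorem.** In $K$ the following truth value exists and $$[\![(\forall X)(\forall m)(\exists x_1)(\exists x_2)\,\varphi(X,m,x_1,x_2)]\!]=\mathbf 0 .$$ Moreover, this is witnessed by the wide limit, read as a map from $\{0,\dots,n-1\}$ to $\{0,\dots,n/2-1\}$: there is a unary $\Theta\in G_{nb}$ such that $K[\![\Theta(\alpha)=\beta]\!]=\lim_{F_{nb}}M_{n,\lfloor n/2\rfloor}[\![E(\alpha,\beta)]\!]$ for all $\alpha,\beta$ in the universe of the wide limit, and $K[\![(\exists x_1)(\exists x_2)\,\varphi(\Theta,n,x_1,x_2)]\!]=\mathbf 0$, where $n$ stands for the constant function $n$, which belongs to $F_{nb}$. -/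

import Mathlib

open FirstOrder

noncomputable section

namespace WideLimit

/-! ### True arithmetic in the language of all functions and relations on `ℕ` -/

/-- The language with a name for every function and every relation on `ℕ`. -/
def LAll : FirstOrder.Language.{0, 0} where
  Functions k := (Fin k → ℕ) → ℕ
  Relations k := (Fin k → ℕ) → Prop

/-- The standard model. -/
instance : LAll.Structure ℕ where
  funMap f v := f v
  RelMap R v := R v

/-- The interpretation in `M` of the name of a standard function. -/
def starF {M : Type*} [LAll.Structure M] {k : ℕ} (f : (Fin k → ℕ) → ℕ) (x : Fin k → M) : M :=
  Language.Structure.funMap (L := LAll) f x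

/-- The interpretation in `M` of the name of a standard relation. -/
def starR {M : Type*} [LAll.Structure M] {k : ℕ} (R : (Fin k → ℕ) → Prop) (x : Fin k → M) : Prop :=
  Language.Structure.RelMap (L := LAll) R x

/-- The element of `M` named by the standard number `k`. -/
def std (M : Type*) [LAll.Structure M] (k : ℕ) : M :=
  starF (fun _ : Fin 0 → ℕ => k) ![]

/-- The elements of `M \ ℕ`. -/
def IsNonstandard {M : Type*} [LAll.Structure M] (x : M) : Prop :=
  ∀ k : ℕ, x ≠ std M k

/-- `M` is `ℵ₁`-saturated: every countable set of formulas in one free variable, with parameters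
from `M`, that is finitely satisfiable in `M`, is realized in `M`. -/
def IsAlephOneSaturated (M : Type*) [LAll.Structure M] : Prop :=
  ∀ Φ : Set (LAll.Formula (M ⊕ Unit)), Φ.Countable →
    (∀ Ψ : Set (LAll.Formula (M ⊕ Unit)), Ψ ⊆ Φ → Ψ.Finite →
      ∃ x : M, ∀ φ ∈ Ψ, φ.Realize (Sum.elim id fun _ => x)) →
    ∃ x : M, ∀ φ ∈ Φ, φ.Realize (Sum.elim id fun _ => x)

/-! #### Transfer between `ℕ` and `M` -/

section Transfer

variable {M : Type*} [LAll.Structure M] [M ⊨ LAll.completeTheory ℕ] {k l : ℕ}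

theorem transfer (φ : LAll.Formula (Fin k)) (h : ∀ v : Fin k → ℕ, φ.Realize v) (x : Fin k → M) :
    φ.Realize x := by
  let ψ : LAll.Formula (Empty ⊕ Fin k) := φ.relabel Sum.inr
  have h1 : ℕ ⊨ (ψ.iAlls (Fin k) : LAll.Sentence) := by
    refine Language.Formula.realize_iAlls.2 fun v => ?_
    simpa [ψ, Language.Formula.realize_relabel] using h _
  have h2 : M ⊨ (ψ.iAlls (Fin k) : LAll.Sentence) :=
    (Language.realize_iff_of_model_completeTheory ℕ M _).2 h1
  have h3 := Language.Formula.realize_iAlls.1 h2 x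
  simpa [ψ, Language.Formula.realize_relabel] using h3

/-- The atomic formula naming a standard relation, with its variables in order. -/
def relFormula (R : (Fin k → ℕ) → Prop) : LAll.Formula (Fin k) :=
  Language.Relations.formula (L := LAll) (n := k) R fun i => Language.Term.var i

theorem realize_relFormula {N : Type*} [LAll.Structure N] (R : (Fin k → ℕ) → Prop)
    (x : Fin k → N) : (relFormula R).Realize x ↔ starR R x := by
  exact Language.Formula.realize_rel

theorem starR_of_forall {R : (Fin k → ℕ) → Prop} (h : ∀ v, R v) (x : Fin k → M) : starR R x :=
  (realize_relFormula R x).1 (transfer _ (fun v => (realize_relFormula R v).2 (h v)) x)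

/-- The term applying the name of a standard function to the variables, in order. -/
def funTerm (f : (Fin k → ℕ) → ℕ) : LAll.Term (Fin k) :=
  Language.Term.func (L := LAll) f fun i => Language.Term.var i

theorem realize_funTerm {N : Type*} [LAll.Structure N] (f : (Fin k → ℕ) → ℕ) (x : Fin k → N) :
    (funTerm f).realize x = starF f x := rfl

theorem starR_comp (R : (Fin l → ℕ) → Prop) (g : Fin l → (Fin k → ℕ) → ℕ) (x : Fin k → M) :
    starR (fun v => R fun i => g i v) x ↔ starR R fun i => starF (g i) x := by
  have h := transfer (M := M) ((relFormula fun v => R fun i => g i v).iff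
      (Language.Relations.formula (L := LAll) (n := l) R fun i => funTerm (g i)))
    (fun v => by
      rw [Language.Formula.realize_iff, realize_relFormula]
      exact Iff.symm Language.Formula.realize_rel) x
  rw [Language.Formula.realize_iff, realize_relFormula] at h
  exact h.trans Language.Formula.realize_rel

theorem starF_comp (f : (Fin l → ℕ) → ℕ) (g : Fin l → (Fin k → ℕ) → ℕ) (x : Fin k → M) :
    starF (fun v => f fun i => g i v) x = starF f fun i => starF (g i) x := by
  have h := transfer (M := M) (Language.Term.equal (funTerm fun v => f fun i => g i v)
      (Language.Term.func (L := LAll) f fun i => funTerm (g i)))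
    (fun v => by
      rw [Language.Formula.realize_equal]
      rfl) x
  rw [Language.Formula.realize_equal] at h
  exact h

theorem starR_not (R : (Fin k → ℕ) → Prop) (x : Fin k → M) :
    starR (fun v => ¬ R v) x ↔ ¬ starR R x := by
  have h := transfer (M := M) ((relFormula fun v => ¬ R v).iff (relFormula R).not)
    (fun v => by
      simp only [Language.Formula.realize_iff, Language.Formula.realize_not, realize_relFormula]
      rfl) x
  simpa only [Language.Formula.realize_iff, Language.Formula.realize_not, realize_relFormula]
    using h

theorem starR_and (R R₁ : (Fin k → ℕ) → Prop) (x : Fin k → M) :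
    starR (fun v => R v ∧ R₁ v) x ↔ (starR R x ∧ starR R₁ x) := by
  have h := transfer (M := M) ((relFormula fun v => R v ∧ R₁ v).iff (relFormula R ⊓ relFormula R₁))
    (fun v => by
      simp only [Language.Formula.realize_iff, Language.Formula.realize_inf, realize_relFormula]
      rfl) x
  simpa only [Language.Formula.realize_iff, Language.Formula.realize_inf, realize_relFormula]
    using h

theorem starR_or (R R₁ : (Fin k → ℕ) → Prop) (x : Fin k → M) :
    starR (fun v => R v ∨ R₁ v) x ↔ (starR R x ∨ starR R₁ x) := by
  have h := transfer (M := M) ((relFormula fun v => R v ∨ R₁ v).iff (relFormula R ⊔ relFormula R₁))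
    (fun v => by
      simp only [Language.Formula.realize_iff, Language.Formula.realize_sup, realize_relFormula]
      rfl) x
  simpa only [Language.Formula.realize_iff, Language.Formula.realize_sup, realize_relFormula]
    using h

theorem starR_mono {R R₁ : (Fin k → ℕ) → Prop} (h : ∀ v, R v → R₁ v) (x : Fin k → M)
    (hx : starR R x) : starR R₁ x := by
  have h1 : starR (fun v => ¬ R v ∨ R₁ v) x :=
    starR_of_forall (fun v => by have := h v; tauto) x
  rw [starR_or, starR_not] at h1
  tauto

theorem starF_proj (i : Fin k) (x : Fin k → M) : starF (fun v : Fin k → ℕ => v i) x = x i := by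
  have h := transfer (M := M) (Language.Term.equal (funTerm fun v : Fin k → ℕ => v i)
      (Language.Term.var i))
    (fun v => by rw [Language.Formula.realize_equal]; rfl) x
  rw [Language.Formula.realize_equal] at h
  exact h

theorem starF_const (c : ℕ) (x : Fin k → M) : starF (fun _ : Fin k → ℕ => c) x = std M c := by
  have h := starF_comp (fun _ : Fin 0 → ℕ => c) (fun _ _ => 0) x
  refine h.trans ?_
  rw [std]
  congr 1
  exact Subsingleton.elim _ _

theorem starR_comp₂ (R : (Fin 2 → ℕ) → Prop) (f g : (Fin k → ℕ) → ℕ) (x : Fin k → M) :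
    starR (fun v => R ![f v, g v]) x ↔ starR R ![starF f x, starF g x] := by
  have h := starR_comp R ![f, g] x
  have e1 : (fun v => R fun i => (![f, g] : Fin 2 → (Fin k → ℕ) → ℕ) i v) =
      fun v => R ![f v, g v] := by
    funext v; congr 1; funext i; fin_cases i <;> rfl
  have e2 : (fun i => starF ((![f, g] : Fin 2 → (Fin k → ℕ) → ℕ) i) x) =
      ![starF f x, starF g x] := by
    funext i; fin_cases i <;> rfl
  rwa [e1, e2] at h

theorem starF_comp₂ (F : (Fin 2 → ℕ) → ℕ) (f g : (Fin k → ℕ) → ℕ) (x : Fin k → M) :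
    starF (fun v => F ![f v, g v]) x = starF F ![starF f x, starF g x] := by
  have h := starF_comp F ![f, g] x
  have e1 : (fun v => F fun i => (![f, g] : Fin 2 → (Fin k → ℕ) → ℕ) i v) =
      fun v => F ![f v, g v] := by
    funext v; congr 1; funext i; fin_cases i <;> rfl
  have e2 : (fun i => starF ((![f, g] : Fin 2 → (Fin k → ℕ) → ℕ) i) x) =
      ![starF f x, starF g x] := by
    funext i; fin_cases i <;> rfl
  rwa [e1, e2] at h

end Transfer

/-! ### Arithmetic, finite sets and finite functions inside `M` -/

section Internal

variable {M : Type*} [LAll.Structure M]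

/-- The order of `M`. -/
def le (x y : M) : Prop := starR (fun v : Fin 2 → ℕ => v 0 ≤ v 1) ![x, y]

/-- The strict order of `M`. -/
def lt (x y : M) : Prop := starR (fun v : Fin 2 → ℕ => v 0 < v 1) ![x, y]

/-- The finite set coded by a number: `i` belongs to it when the `i`-th binary digit is `1`. -/
def decodeSet (a : ℕ) : Finset ℕ := Finset.equivBitIndices a

/-- The number coding a finite set. -/
def codeSet (s : Finset ℕ) : ℕ := Finset.equivBitIndices.symm s

/-- Membership of `x` in the set coded by `a`, inside `M`. -/
def mem (x a : M) : Prop := starR (fun v : Fin 2 → ℕ => v 0 ∈ decodeSet (v 1)) ![x, a]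

/-- The pairing function `⟨x, y⟩`, inside `M`. -/
def pair (x y : M) : M := starF (fun v : Fin 2 → ℕ => Nat.pair (v 0) (v 1)) ![x, y]

/-- A relation on `M` is coded when the codes of the tuples that satisfy it are the elements of a
set coded by an element of `M`. -/
def IsCoded {k : ℕ} (R : (Fin k → M) → Prop) : Prop :=
  ∃ c : M, ∀ x : Fin k → M, R x ↔ mem (starF (fun v : Fin k → ℕ => Encodable.encode v) x) c

/-- `n ^ (1 / t)`, rounded to the nearest element of `M`. -/
def root (n t : M) : M :=
  starF (fun v : Fin 2 → ℕ => (round ((v 0 : ℝ) ^ (1 / (v 1 : ℝ)))).toNat) ![n, t]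

/-- The cut `M_n` of all numbers bounded by `2 ^ (n ^ (1 / t))` for some nonstandard `t`. -/
def cut (n : M) : Set M :=
  {x | ∃ t : M, IsNonstandard t ∧ le x (starF (fun v : Fin 1 → ℕ => 2 ^ v 0) ![root n t])}

/-- The elements of the set coded by `S`, used as a space of samples. -/
def Sample (S : M) : Type _ := {ω : M // mem ω S}

/-! ### The Boolean algebra of coded events modulo infinitesimal ones -/

section Boolean

variable [M ⊨ LAll.completeTheory ℕ]

theorem starR_mem {k : ℕ} (f g : (Fin k → ℕ) → ℕ) (x : Fin k → M) :
    starR (fun v => f v ∈ decodeSet (g v)) x ↔ mem (starF f x) (starF g x) :=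
  starR_comp₂ (fun v : Fin 2 → ℕ => v 0 ∈ decodeSet (v 1)) f g x

theorem not_mem_empty (x : M) : ¬ mem x (std M (codeSet ∅)) := by
  have h := starR_of_forall (M := M) (R := fun v : Fin 1 → ℕ => ¬ v 0 ∈ decodeSet (codeSet ∅))
    (fun v => by simp [decodeSet, codeSet]) ![x]
  rw [starR_not, starR_mem (fun v => v 0) (fun _ => codeSet ∅), starF_proj, starF_const] at h
  exact h

/-- A binary operation on finite sets, as an operation on codes. -/
def setOp (op : Finset ℕ → Finset ℕ → Finset ℕ) (v : Fin 2 → ℕ) : ℕ :=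
  codeSet (op (decodeSet (v 0)) (decodeSet (v 1)))

theorem starF_setOp (op : Finset ℕ → Finset ℕ → Finset ℕ) {k : ℕ} (f g : (Fin k → ℕ) → ℕ)
    (x : Fin k → M) :
    starF (fun v => codeSet (op (decodeSet (f v)) (decodeSet (g v)))) x =
      starF (setOp op) ![starF f x, starF g x] :=
  starF_comp₂ (setOp op) f g x

theorem mem_union (x a b : M) :
    mem x (starF (setOp (· ∪ ·)) ![a, b]) ↔ mem x a ∨ mem x b := by
  have h := starR_or (fun v : Fin 3 → ℕ => v 0 ∈ decodeSet (v 1))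
    (fun v => v 0 ∈ decodeSet (v 2)) ![x, a, b]
  have e : (fun v : Fin 3 → ℕ => v 0 ∈ decodeSet (v 1) ∨ v 0 ∈ decodeSet (v 2)) =
      fun v => v 0 ∈ decodeSet (codeSet (decodeSet (v 1) ∪ decodeSet (v 2))) := by
    funext v; simp [decodeSet, codeSet]
  rw [e, starR_mem (fun v : Fin 3 → ℕ => v 0)
      (fun v => codeSet (decodeSet (v 1) ∪ decodeSet (v 2))),
    starF_setOp (· ∪ ·) (fun v : Fin 3 → ℕ => v 1) (fun v => v 2),
    starR_mem (fun v : Fin 3 → ℕ => v 0) (fun v => v 1),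
    starR_mem (fun v : Fin 3 → ℕ => v 0) (fun v => v 2)] at h
  simp only [starF_proj] at h
  exact h

theorem mem_sdiff (x a b : M) :
    mem x (starF (setOp (· \ ·)) ![a, b]) ↔ mem x a ∧ ¬ mem x b := by
  have h := starR_and (fun v : Fin 3 → ℕ => v 0 ∈ decodeSet (v 1))
    (fun v => ¬ v 0 ∈ decodeSet (v 2)) ![x, a, b]
  have e : (fun v : Fin 3 → ℕ => v 0 ∈ decodeSet (v 1) ∧ ¬ v 0 ∈ decodeSet (v 2)) =
      fun v => v 0 ∈ decodeSet (codeSet (decodeSet (v 1) \ decodeSet (v 2))) := by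
    funext v; simp [decodeSet, codeSet]
  rw [e, starR_not, starR_mem (fun v : Fin 3 → ℕ => v 0)
      (fun v => codeSet (decodeSet (v 1) \ decodeSet (v 2))),
    starF_setOp (· \ ·) (fun v : Fin 3 → ℕ => v 1) (fun v => v 2),
    starR_mem (fun v : Fin 3 → ℕ => v 0) (fun v => v 1),
    starR_mem (fun v : Fin 3 → ℕ => v 0) (fun v => v 2)] at h
  simp only [starF_proj] at h
  exact h

/-- `𝒜`: the Boolean algebra of those sets of samples that are coded by an element of `M`. -/
def events (S : M) : BooleanSubalgebra (Set (Sample S)) where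
  carrier := {A | ∃ a : M, ∀ ω : Sample S, ω ∈ A ↔ mem ω.1 a}
  supClosed' := by
    rintro A ⟨a, ha⟩ B ⟨b, hb⟩
    exact ⟨starF (setOp (· ∪ ·)) ![a, b], fun ω => by rw [mem_union, ← ha, ← hb]; rfl⟩
  infClosed' := by
    rintro A ⟨a, ha⟩ B ⟨b, hb⟩
    refine ⟨starF (setOp (· \ ·)) ![a, starF (setOp (· \ ·)) ![a, b] ], fun ω => ?_⟩
    rw [mem_sdiff, mem_sdiff, ← ha, ← hb]
    change ω ∈ A ∧ ω ∈ B ↔ _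
    tauto
  compl_mem' := by
    rintro A ⟨a, ha⟩
    refine ⟨starF (setOp (· \ ·)) ![S, a], fun ω => ?_⟩
    rw [mem_sdiff, ← ha]
    exact ⟨fun h => ⟨ω.2, h⟩, fun h => h.2⟩
  bot_mem' := ⟨std M (codeSet ∅), fun ω => ⟨fun h => h.elim, fun h => not_mem_empty _ h⟩⟩

/-- `k · |a| ≤ |b|`, for the sets coded by `a` and `b` and a standard number `k`. -/
def cardLe (k : ℕ) (a b : M) : Prop :=
  starR (fun v : Fin 2 → ℕ => k * (decodeSet (v 0)).card ≤ (decodeSet (v 1)).card) ![a, b]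

/-- The event `A` has infinitesimal counting measure: `|A| / |S| ≤ 1 / k` for every standard
`k ≥ 1`. -/
def IsNull {S : M} (A : Set (Sample S)) : Prop :=
  ∃ a : M, (∀ x : M, mem x a ↔ ∃ h : mem x S, (⟨x, h⟩ : Sample S) ∈ A) ∧ ∀ k : ℕ, cardLe k a S

theorem cardLe_of_forall {k : ℕ} {f : (Fin 3 → ℕ) → ℕ} {R : (Fin 3 → ℕ) → Prop} {x : Fin 3 → M}
    (h : ∀ v, R v → k * (decodeSet (f v)).card ≤ (decodeSet (v 2)).card) (hx : starR R x) :
    cardLe k (starF f x) (x 2) := by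
  have h1 := starR_mono h x hx
  have h2 := (starR_comp₂ (fun v : Fin 2 → ℕ =>
    k * (decodeSet (v 0)).card ≤ (decodeSet (v 1)).card) f (fun v => v 2) x).1 h1
  rwa [starF_proj] at h2

theorem isNull_mono {S : M} {A B : Set (Sample S)} (hA : A ∈ events S) (hAB : A ⊆ B)
    (hB : IsNull B) : IsNull A := by
  obtain ⟨a, ha⟩ := hA
  obtain ⟨b, hb, hk⟩ := hB
  refine ⟨starF (setOp (· \ ·)) ![b, starF (setOp (· \ ·)) ![b, a] ], fun x => ?_, fun k => ?_⟩
  · rw [mem_sdiff, mem_sdiff]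
    constructor
    · rintro ⟨h1, h2⟩
      obtain ⟨hx, -⟩ := (hb x).1 h1
      refine ⟨hx, (ha ⟨x, hx⟩).2 ?_⟩
      by_contra h3
      exact h2 ⟨h1, h3⟩
    · rintro ⟨hx, h⟩
      exact ⟨(hb x).2 ⟨hx, hAB h⟩, fun h3 => h3.2 ((ha ⟨x, hx⟩).1 h)⟩
  · have h1 : starR (fun v : Fin 3 → ℕ => k * (decodeSet (v 0)).card ≤ (decodeSet (v 2)).card)
        ![b, a, S] := by
      have := starR_comp₂ (fun v : Fin 2 → ℕ =>
        k * (decodeSet (v 0)).card ≤ (decodeSet (v 1)).card) (fun v : Fin 3 → ℕ => v 0)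
        (fun v => v 2) ![b, a, S]
      rw [starF_proj, starF_proj] at this
      exact this.2 (hk k)
    have h2 := cardLe_of_forall (f := fun v => codeSet (decodeSet (v 0) \
        decodeSet (codeSet (decodeSet (v 0) \ decodeSet (v 1))))) (fun v hv => by
      refine le_trans (Nat.mul_le_mul le_rfl (Finset.card_le_card ?_)) hv
      simp [decodeSet, codeSet]) h1
    rw [starF_setOp (· \ ·) (fun v : Fin 3 → ℕ => v 0)
        (fun v => codeSet (decodeSet (v 0) \ decodeSet (v 1))),
      starF_setOp (· \ ·) (fun v : Fin 3 → ℕ => v 0) (fun v => v 1), starF_proj, starF_proj] at h2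
    exact h2

theorem isNull_union {S : M} {A B : Set (Sample S)} (hA : IsNull A) (hB : IsNull B) :
    IsNull (A ∪ B) := by
  obtain ⟨a, ha, hka⟩ := hA
  obtain ⟨b, hb, hkb⟩ := hB
  refine ⟨starF (setOp (· ∪ ·)) ![a, b], fun x => ?_, fun k => ?_⟩
  · rw [mem_union, ha, hb, ← exists_or]
    rfl
  · have h1 : starR (fun v : Fin 3 → ℕ =>
        (2 * k) * (decodeSet (v 0)).card ≤ (decodeSet (v 2)).card ∧
        (2 * k) * (decodeSet (v 1)).card ≤ (decodeSet (v 2)).card) ![a, b, S] := by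
      rw [starR_and]
      have h3 := starR_comp₂ (fun v : Fin 2 → ℕ =>
        (2 * k) * (decodeSet (v 0)).card ≤ (decodeSet (v 1)).card) (fun v : Fin 3 → ℕ => v 0)
        (fun v => v 2) ![a, b, S]
      have h4 := starR_comp₂ (fun v : Fin 2 → ℕ =>
        (2 * k) * (decodeSet (v 0)).card ≤ (decodeSet (v 1)).card) (fun v : Fin 3 → ℕ => v 1)
        (fun v => v 2) ![a, b, S]
      rw [starF_proj, starF_proj] at h3 h4
      exact ⟨h3.2 (hka _), h4.2 (hkb _)⟩
    have h2 := cardLe_of_forall (k := k)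
      (f := fun v => codeSet (decodeSet (v 0) ∪ decodeSet (v 1))) (fun v hv => by
        have hc : decodeSet (codeSet (decodeSet (v 0) ∪ decodeSet (v 1))) =
            decodeSet (v 0) ∪ decodeSet (v 1) := by simp [decodeSet, codeSet]
        rw [hc]
        have := Nat.mul_le_mul (le_refl k) (Finset.card_union_le (decodeSet (v 0)) (decodeSet (v 1)))
        nlinarith [hv.1, hv.2]) h1
    rw [starF_setOp (· ∪ ·) (fun v : Fin 3 → ℕ => v 0) (fun v => v 1), starF_proj,
      starF_proj] at h2
    exact h2

/-- `ℐ`: the ideal of events of infinitesimal counting measure, in the Boolean ring of events. -/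
def nullIdeal (S : M) : Ideal (AsBoolRing (events S)) where
  carrier := {A | IsNull (ofBoolRing A : events S).1}
  zero_mem' := by
    refine ⟨std M (codeSet ∅), fun x => ⟨fun h => (not_mem_empty _ h).elim, fun h => ?_⟩, fun k => ?_⟩
    · exact h.2.elim
    · have h := starR_of_forall (M := M) (R := fun v : Fin 1 → ℕ =>
        k * (decodeSet (codeSet ∅)).card ≤ (decodeSet (v 0)).card)
        (fun v => by simp [decodeSet, codeSet]) ![S]
      have h2 := (starR_comp₂ (fun v : Fin 2 → ℕ =>
        k * (decodeSet (v 0)).card ≤ (decodeSet (v 1)).card) (fun _ : Fin 1 → ℕ => codeSet ∅)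
        (fun v => v 0) ![S]).1 h
      rwa [starF_const, starF_proj] at h2
  add_mem' := by
    intro A B hA hB
    refine isNull_mono (ofBoolRing (A + B) : events S).2 ?_ (isNull_union hA hB)
    rw [ofBoolRing_add]
    exact symmDiff_le_sup (a := (ofBoolRing A : events S).1) (b := (ofBoolRing B : events S).1)
  smul_mem' := by
    intro C A hA
    refine isNull_mono (ofBoolRing (C * A) : events S).2 ?_ hA
    rw [smul_eq_mul, ofBoolRing_mul]
    exact Set.inter_subset_right

instance (S : M) : BooleanRing (AsBoolRing (events S) ⧸ nullIdeal S) where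
  isIdempotentElem a := by
    induction a using Submodule.Quotient.induction_on with
    | H a => exact congrArg _ (BooleanRing.isIdempotentElem a)

/-- `ℬ = 𝒜 / ℐ`: the Boolean algebra of truth values. -/
abbrev TruthValue (S : M) : Type _ := AsBoolAlg (AsBoolRing (events S) ⧸ nullIdeal S)

/-- The class of an event in `ℬ`. -/
def eventClass {S : M} (A : events S) : TruthValue S :=
  toBoolAlg (Ideal.Quotient.mk (nullIdeal S) (toBoolRing A))

/-- `b` is the truth value `{ω ; P ω} / ℐ`; in particular `{ω ; P ω}` is an event. -/
def IsClassOf {S : M} (P : Sample S → Prop) (b : TruthValue S) : Prop :=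
  ∃ h : {ω | P ω} ∈ events S, b = eventClass ⟨{ω | P ω}, h⟩

end Boolean

end Internal

/-! ### Graphs of maps from `{0, …, k - 1}` to `{0, …, ⌊k/2⌋ - 1}` -/

/-- The number coding the graph of `f`, as a set of coded pairs. -/
def graphCode {k : ℕ} (f : Fin k → Fin k) : ℕ :=
  codeSet (Finset.univ.image fun i : Fin k => Nat.pair i (f i))

/-- The number coding the set of all (codes of) graphs of maps from `{0, …, k - 1}` to
`{0, …, ⌊k/2⌋ - 1}`. -/
def mapGraphs (k : ℕ) : ℕ :=
  codeSet ((Finset.univ.filter fun f : Fin k → Fin k => ∀ i, (f i : ℕ) < k / 2).image graphCode)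

/-! ### Decision trees asking for neighbors -/

/-- Trees whose inner nodes are labeled by `v < k` and have one outgoing edge for each `u < k`, and
whose leaves are labeled by numbers. -/
inductive NbTree (k : ℕ) : Type
  | leaf (m : ℕ) : NbTree k
  | node (v : Fin k) (child : Fin k → NbTree k) : NbTree k

namespace NbTree

variable {k : ℕ}

/-- The maximal number of edges on a path from the root. -/
def depth : NbTree k → ℕ
  | leaf _ => 0
  | node _ child => 1 + Finset.univ.sup fun u => (child u).depth

/-- The labels of the leaves. -/
def leafLabels : NbTree k → Set ℕ
  | leaf m => {m}
  | node _ child => ⋃ u, (child u).leafLabels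

/-- The label of the leaf that is reached when a node labeled `v` is left along the edge
labeled `f v`. -/
def output (f : Fin k → Fin k) : NbTree k → ℕ
  | leaf m => m
  | node v child => (child (f v)).output f

/-- A numbering of the trees. -/
def code : NbTree k → ℕ
  | leaf m => 2 * m
  | node v child => 2 * Nat.pair v (Encodable.encode fun u => (child u).code) + 1

theorem code_injective : Function.Injective (code : NbTree k → ℕ) := by
  intro T
  induction T with
  | leaf m =>
    intro T' h
    cases T' with
    | leaf m' => simp only [code] at h; congr 1; omega
    | node v' c' => simp only [code] at h; omega
  | node v c ih =>
    intro T' h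
    cases T' with
    | leaf m' => simp only [code] at h; omega
    | node v' c' =>
      simp only [code] at h
      have h1 : Nat.pair v (Encodable.encode fun u => (c u).code) =
          Nat.pair v' (Encodable.encode fun u => (c' u).code) := by omega
      rw [Nat.pair_eq_pair] at h1
      have hv : v = v' := Fin.ext h1.1
      have hc := Encodable.encode_injective h1.2
      have : c = c' := funext fun u => ih u (congrFun hc u)
      rw [hv, this]

end NbTree

section Models

variable {M : Type*} [LAll.Structure M]

/-- The value at `n` of the nonstandard prolongation of the sequence `k ↦ M_{k,⌊k/2⌋}`. -/
def samples (n : M) : M := starF (fun v : Fin 1 → ℕ => mapGraphs (v 0)) ![n]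

/-- `T` is (the code of) a tree of `M`, with labels below `n`, whose depth is at most
`n ^ (1 / t)` for some nonstandard `t`, and whose leaves are labeled by elements of `M_n`. -/
def IsNbTree (n T : M) : Prop :=
  (∃ t : M, IsNonstandard t ∧
    starR (fun v : Fin 3 → ℕ => ∃ T : NbTree (v 0), T.code = v 1 ∧ T.depth ≤ v 2)
      ![n, T, root n t]) ∧
  ∀ m : M, starR (fun v : Fin 3 → ℕ => ∃ T : NbTree (v 0), T.code = v 1 ∧ v 2 ∈ T.leafLabels)
    ![n, T, m] → m ∈ cut n

/-- The tree `T` with labels below `n` outputs `y` on the map whose graph is `ω`. -/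
def Outputs (n T ω y : M) : Prop :=
  starR (fun v : Fin 4 → ℕ => ∃ (T : NbTree (v 0)) (f : Fin (v 0) → Fin (v 0)),
    T.code = v 1 ∧ graphCode f = v 2 ∧ T.output f = v 3) ![n, T, ω, y]

/-- `F_nb`: the functions on the samples that are computed by the trees above. -/
def Fnb (n : M) : Set (Sample (samples n) → M) :=
  {α | ∃ T : M, IsNbTree n T ∧ ∀ ω, Outputs n T ω.1 (α ω)}

/-- The vertices among the random variables of `F`: those with all values below `n`. -/
def vertices {S : M} (n : M) (F : Set (Sample S → M)) : Set (Sample S → M) :=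
  {α | α ∈ F ∧ ∀ ω, lt (α ω) n}

/-- `E_ω(x, y)`, for the structure with edge relation coded by `ω`. -/
def Edge (ω x y : M) : Prop := mem (pair x y) ω

/-- A `k`-ary random function: it assigns to each sample `ω` a finite partial function from
`k`-tuples of elements of `M_n` to `M_n`, and it is coded by an element of `M`. -/
structure RandomFunction (S n : M) (k : ℕ) where
  toFun : Sample S → (Fin k → M) → Option M
  mem_cut : ∀ ω x y, toFun ω x = some y → (∀ i, x i ∈ cut n) ∧ y ∈ cut n
  coded : IsCoded fun v : Fin (k + 2) → M =>
    ∃ h : mem (v 0) S, toFun ⟨v 0, h⟩ (fun i : Fin k => v i.succ.castSucc) =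
      some (v (Fin.last (k + 1)))

/-- The value of `Θ_ω` at `x`, or `0` outside the domain of `Θ_ω`. -/
def RandomFunction.apply {S n : M} {k : ℕ} (Θ : RandomFunction S n k) (ω : Sample S)
    (x : Fin k → M) : M :=
  (Θ.toFun ω x).getD (std M 0)

open Classical in
/-- `G_nb`, arity by arity. A unary function is given by a coded tuple `γ_0, …, γ_{m-1}` of elements
of `F_nb`; the last two arguments of a function of larger arity are merged by the pairing
function. -/
def Gnb (n : M) : (k : ℕ) → Set (RandomFunction (samples n) n k)
  | 0 => {Θ | ∃ γ ∈ Fnb n, ∀ ω, Θ.apply ω ![] = γ ω}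
  | 1 => {Θ | ∃ (m : M) (γ : M → Sample (samples n) → M),
      IsCoded (fun v : Fin 3 → M =>
        lt (v 0) m ∧ ∃ h : mem (v 1) (samples n), γ (v 0) ⟨v 1, h⟩ = v 2) ∧
      (∀ i, lt i m → γ i ∈ Fnb n) ∧
      ∀ α ∈ Fnb n, ∀ ω,
        Θ.apply ω ![α ω] = if lt (α ω) m then γ (α ω) ω else std M 0}
  | k + 2 => {Θ | ∃ Θ' ∈ Gnb n (k + 1), ∀ α : Fin (k + 2) → Sample (samples n) → M,
      (∀ i, α i ∈ Fnb n) → ∀ ω,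
        Θ.apply ω (fun i => α i ω) =
          Θ'.apply ω (Fin.snoc (α := fun _ => M) (fun i : Fin k => α i.castSucc.castSucc ω)
            (pair (α (Fin.last k).castSucc ω) (α (Fin.last (k + 1)) ω)))}

/-! ### Two-sorted formulas and their truth values in `K(S, F, G)` -/

/-- The language `L_n`: all relation symbols, and those function symbols whose values on elements
of `M_n` stay in `M_n`. -/
def Ln (n : M) : FirstOrder.Language.{0, 0} where
  Functions k := {f : LAll.Functions k // ∀ x : Fin k → M, (∀ i, x i ∈ cut n) → starF f x ∈ cut n}
  Relations k := LAll.Relations k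

end Models

/-- Terms of the language `L²`. Number variables are indexed by `ℕ`, and so are the set variables
of each arity `k`, which are used as function symbols. -/
inductive Term₂ (L : FirstOrder.Language.{0, 0}) : Type
  | var (i : ℕ) : Term₂ L
  | func {k : ℕ} (f : L.Functions k) (ts : Fin k → Term₂ L) : Term₂ L
  | app {k : ℕ} (X : ℕ) (ts : Fin k → Term₂ L) : Term₂ L

/-- Formulas of the language `L²`. -/
inductive Formula₂ (L : FirstOrder.Language.{0, 0}) : Type
  | eq (s t : Term₂ L) : Formula₂ L
  | rel {k : ℕ} (R : L.Relations k) (ts : Fin k → Term₂ L) : Formula₂ L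
  | setEq (k X Y : ℕ) : Formula₂ L
  | not (φ : Formula₂ L) : Formula₂ L
  | and (φ ψ : Formula₂ L) : Formula₂ L
  | or (φ ψ : Formula₂ L) : Formula₂ L
  | allNum (i : ℕ) (φ : Formula₂ L) : Formula₂ L
  | exNum (i : ℕ) (φ : Formula₂ L) : Formula₂ L
  | allSet (k X : ℕ) (φ : Formula₂ L) : Formula₂ L
  | exSet (k X : ℕ) (φ : Formula₂ L) : Formula₂ L

section Semantics

variable {M : Type*} [LAll.Structure M]

/-- Assignments of random variables and random functions to the variables. -/
structure Assignment (S n : M) where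
  num : ℕ → Sample S → M
  set : (k : ℕ) → ℕ → RandomFunction S n k

instance [M ⊨ LAll.completeTheory ℕ] (S n : M) : Inhabited (Assignment S n) where
  default :=
    { num := fun _ _ => std M 0
      set := fun _ _ =>
        { toFun := fun _ _ => none
          mem_cut := fun _ _ _ h => by cases h
          coded := ⟨std M (codeSet ∅), fun _ =>
            ⟨fun h => absurd h.2 (by simp), fun h => (not_mem_empty _ h).elim⟩⟩ } }

/-- The assignment that differs from `e` in giving the value `α` to the number variable `i`. -/
def Assignment.setNum {S n : M} (e : Assignment S n) (i : ℕ) (α : Sample S → M) :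
    Assignment S n where
  num := Function.update e.num i α
  set := e.set

/-- The assignment that differs from `e` in giving the value `Θ` to the set variable `X` of
arity `k`. -/
def Assignment.setSet {S n : M} (e : Assignment S n) {k : ℕ} (X : ℕ) (Θ : RandomFunction S n k) :
    Assignment S n where
  num := e.num
  set := Function.update e.set k (Function.update (e.set k) X Θ)

/-- The random variable denoted by a term. When the variables take values in a family `F` that is
closed under the functions of `L_n` and under the random functions in use, it belongs to `F`. -/
def Term₂.eval {S n : M} (e : Assignment S n) : Term₂ (Ln n) → Sample S → M
  | var i, ω => e.num i ω
  | func f ts, ω => starF f.1 fun i => (ts i).eval e ω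
  | app (k := k) X ts, ω => (e.set k X).apply ω fun i => (ts i).eval e ω

/-- `HasValue F G φ e b`: under the assignment `e`, the truth value of `φ` in `K(S, F, G)` exists
and equals `b`. Number quantifiers range over `F`, and quantifiers over set variables of arity `k`
range over the `k`-ary elements of `G`; they are interpreted by infima and suprema in `ℬ`. -/
def HasValue [M ⊨ LAll.completeTheory ℕ] {S n : M} (F : Set (Sample S → M))
    (G : (k : ℕ) → Set (RandomFunction S n k)) :
    Formula₂ (Ln n) → Assignment S n → TruthValue S → Prop
  | .eq s t, e, b => IsClassOf (fun ω => s.eval e ω = t.eval e ω) b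
  | .rel R ts, e, b => IsClassOf (fun ω => starR R fun i => (ts i).eval e ω) b
  | .setEq k X Y, e, b => IsClassOf (fun ω => (e.set k X).toFun ω = (e.set k Y).toFun ω) b
  | .not φ, e, b => ∃ c, HasValue F G φ e c ∧ b = cᶜ
  | .and φ ψ, e, b => ∃ c d, HasValue F G φ e c ∧ HasValue F G ψ e d ∧ b = c ⊓ d
  | .or φ ψ, e, b => ∃ c d, HasValue F G φ e c ∧ HasValue F G ψ e d ∧ b = c ⊔ d
  | .allNum i φ, e, b => ∃ v : F → TruthValue S,
      (∀ α : F, HasValue F G φ (e.setNum i α) (v α)) ∧ IsGLB (Set.range v) b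
  | .exNum i φ, e, b => ∃ v : F → TruthValue S,
      (∀ α : F, HasValue F G φ (e.setNum i α) (v α)) ∧ IsLUB (Set.range v) b
  | .allSet k X φ, e, b => ∃ v : G k → TruthValue S,
      (∀ Θ : G k, HasValue F G φ (e.setSet X Θ.1) (v Θ)) ∧ IsGLB (Set.range v) b
  | .exSet k X φ, e, b => ∃ v : G k → TruthValue S,
      (∀ Θ : G k, HasValue F G φ (e.setSet X Θ.1) (v Θ)) ∧ IsLUB (Set.range v) b

end Semantics

/-! ### The formula expressing that a pair is a solution of WeakPigeon -/

section Pigeon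

variable {M : Type*} [LAll.Structure M] [M ⊨ LAll.completeTheory ℕ] {n : M}

theorem starF_mem_cut {k : ℕ} {f : (Fin k → ℕ) → ℕ} (i : Fin k) (hf : ∀ v, f v ≤ v i)
    (x : Fin k → M) (hx : ∀ i, x i ∈ cut n) : starF f x ∈ cut n := by
  obtain ⟨t, ht, hle⟩ := hx i
  refine ⟨t, ht, ?_⟩
  have h1 : le (starF f x) (x i) := by
    have h := starR_of_forall (M := M) (R := fun v : Fin k → ℕ => f v ≤ v i) hf x
    have h2 := (starR_comp₂ (fun v : Fin 2 → ℕ => v 0 ≤ v 1) f (fun v => v i) x).1 h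
    rwa [starF_proj] at h2
  generalize starF f x = a at h1 ⊢
  generalize starF (fun v : Fin 1 → ℕ => 2 ^ v 0) ![root n t] = c at hle ⊢
  generalize x i = b at h1 hle
  have e : ∀ i j : Fin 3, starR (fun v : Fin 3 → ℕ => v i ≤ v j) ![a, b, c] ↔
      le (![a, b, c] i) (![a, b, c] j) := by
    intro i j
    have h := starR_comp₂ (fun v : Fin 2 → ℕ => v 0 ≤ v 1) (fun v : Fin 3 → ℕ => v i)
      (fun v => v j) ![a, b, c]
    rwa [starF_proj, starF_proj] at h
  have h := starR_mono (R := fun v : Fin 3 → ℕ => v 0 ≤ v 1 ∧ v 1 ≤ v 2)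
    (R₁ := fun v => v 0 ≤ v 2) (fun v hv => hv.1.trans hv.2) ![a, b, c]
    ((starR_and _ _ _).2 ⟨(e 0 1).2 h1, (e 1 2).2 hle⟩)
  exact (e 0 2).1 h

theorem std_mem_cut (hn : IsNonstandard n) {c : ℕ} (hc : c ≤ 1) : std M c ∈ cut n := by
  refine ⟨n, hn, ?_⟩
  have h := starR_of_forall (M := M) (R := fun v : Fin 1 → ℕ => c ≤ 2 ^ v 0)
    (fun v => hc.trans Nat.one_le_two_pow) ![root n n]
  have h2 := (starR_comp₂ (fun v : Fin 2 → ℕ => v 0 ≤ v 1) (fun _ : Fin 1 → ℕ => c)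
    (fun v => 2 ^ v 0) ![root n n]).1 h
  rwa [starF_const] at h2

/-- The constant `0`. -/
def zeroTerm (hn : IsNonstandard n) : Term₂ (Ln n) :=
  .func (L := Ln n) (k := 0) ⟨fun _ => 0, fun x _ => by
    rw [starF_const]; exact std_mem_cut hn zero_le_one⟩ ![]

/-- The constant `1`. -/
def oneTerm (hn : IsNonstandard n) : Term₂ (Ln n) :=
  .func (L := Ln n) (k := 0) ⟨fun _ => 1, fun x _ => by
    rw [starF_const]; exact std_mem_cut hn le_rfl⟩ ![]

/-- The bit length `|t|`. -/
def lenTerm (t : Term₂ (Ln n)) : Term₂ (Ln n) :=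
  .func (L := Ln n) (k := 1) ⟨fun v => Nat.size (v 0), starF_mem_cut 0 fun _ =>
    Nat.size_le.2 Nat.lt_two_pow_self⟩ ![t]

/-- The (truncated) difference `s - t`. -/
def subTerm (s t : Term₂ (Ln n)) : Term₂ (Ln n) :=
  .func (L := Ln n) (k := 2) ⟨fun v => v 0 - v 1, starF_mem_cut 0 fun _ => Nat.sub_le _ _⟩ ![s, t]

/-- The formula `s < t`. -/
def ltFormula (s t : Term₂ (Ln n)) : Formula₂ (Ln n) :=
  .rel (L := Ln n) (k := 2) (fun v => v 0 < v 1) ![s, t]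

/-- The formula `s ≥ t`. -/
def geFormula (s t : Term₂ (Ln n)) : Formula₂ (Ln n) :=
  .rel (L := Ln n) (k := 2) (fun v => v 0 ≥ v 1) ![s, t]

/-- `|X(x₁)| ≥ |m| - 1 ∨ |X(x₂)| ≥ |m| - 1 ∨ (x₁ ≠ x₂ ∧ X(x₁) = X(x₂))`, where `X` is a unary set
variable. -/
def weakPigeon₀ (hn : IsNonstandard n) (X m x₁ x₂ : ℕ) : Formula₂ (Ln n) :=
  .or (.or
    (geFormula (lenTerm (.app X ![.var x₁])) (subTerm (lenTerm (.var m)) (oneTerm hn)))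
    (geFormula (lenTerm (.app X ![.var x₂])) (subTerm (lenTerm (.var m)) (oneTerm hn))))
    (.and (.not (.eq (.var x₁) (.var x₂))) (.eq (.app X ![.var x₁]) (.app X ![.var x₂])))

/-- `m = 0 ∨ (|x₁| < |m| ∧ |x₂| < |m| ∧ weakPigeon₀(X, m, x₁, x₂))`: the values `x₁` and `x₂` are a
solution of the instance `(X, m)` of WeakPigeon. -/
def weakPigeon (hn : IsNonstandard n) (X m x₁ x₂ : ℕ) : Formula₂ (Ln n) :=
  .or (.eq (.var m) (zeroTerm hn))
    (.and (.and (ltFormula (lenTerm (.var x₁)) (lenTerm (.var m)))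
      (ltFormula (lenTerm (.var x₂)) (lenTerm (.var m)))) (weakPigeon₀ hn X m x₁ x₂))

/-- The sentence `(∀ X) (∀ m) (∃ x₁) (∃ x₂) weakPigeon(X, m, x₁, x₂)`. -/
def weakPigeonTotal (hn : IsNonstandard n) : Formula₂ (Ln n) :=
  .allSet 1 0 (.allNum 0 (.exNum 1 (.exNum 2 (weakPigeon hn 0 0 1 2))))

end Pigeon

end WideLimit

end

/-!
The witness `Θ` is the sampled map itself. Solutions of the instance `(Θ, n)` are collisions: since
`n` is a power of two, `|x| < |n|` says `x < n`, and all values of the sampled map lie below `n / 2`,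
so that a solution consists of two distinct points below `n` with the same value. Two random
variables `α, β` of `F_nb` are computed by trees of depth at most `d = n ^ (1 / t)`, for a
nonstandard `t`. Run both trees and then ask for the values at their outputs: these are at most
`q = 2 d + 2` queries, and each new query hits one of the earlier values with probability at most
`q / (n / 2)`. So `(α, β)` is a collision with probability at most `q² / (n / 2)`, which is
infinitesimal, and every instance of the existential formula has the value `⊥`
(`NbTree.card_collision_extensions_le`, `isNull_collision`, `collision_of_isSolution`).

The truth value of the universal sentence is then `⊥`, provided that it exists. For an arbitrary
random function `Θ` and arbitrary random variables the atomic formulas define coded events, because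
elements of `F_nb` and coded random functions are sections of prolongations of standard functions
(`IsInternal`, `RandomFunction.isInternal_apply`, `exists_hasValue_weakPigeon`). The suprema and
infima exist because the algebra of truth values is complete. This is where saturation is used: a
sequence of events approximates a supremum in measure up to `1 / k` for every standard `k`, and
saturation provides one coded event that represents it (`IsAlephOneSaturated.exists_isLUB`).

Facts about `M` are obtained by transfer: a universally quantified statement about numbers is proved
in `ℕ`, and `starR_imp`, `starR_and`, `starF_comp₁` and their companions distribute the prolongation
over its connectives and terms.
-/

namespace WideLimit

/-! ### Transfer of compound relations and functions -/

section Transfer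

variable {M : Type*} [LAll.Structure M] [M ⊨ LAll.completeTheory ℕ] {k l : ℕ}

theorem starR_imp (R R₁ : (Fin k → ℕ) → Prop) (x : Fin k → M) :
    starR (fun v => R v → R₁ v) x ↔ (starR R x → starR R₁ x) := by
  have e : (fun v => R v → R₁ v) = fun v => ¬ R v ∨ R₁ v := by
    funext v
    exact propext imp_iff_not_or
  rw [e, starR_or, starR_not, imp_iff_not_or]

theorem starR_false (x : Fin k → M) : starR (fun _ => False) x ↔ False :=
  iff_false_intro ((starR_not _ x).1 (starR_of_forall (fun _ => not_false) x))

theorem starR_iff (R R₁ : (Fin k → ℕ) → Prop) (x : Fin k → M) :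
    starR (fun v => R v ↔ R₁ v) x ↔ (starR R x ↔ starR R₁ x) := by
  have e : (fun v => R v ↔ R₁ v) = fun v => (R v → R₁ v) ∧ (R₁ v → R v) := by
    funext v
    exact propext iff_iff_implies_and_implies
  rw [e, starR_and, starR_imp, starR_imp]
  exact iff_iff_implies_and_implies.symm

theorem starR_le (f g : (Fin k → ℕ) → ℕ) (x : Fin k → M) :
    starR (fun v => f v ≤ g v) x ↔ le (starF f x) (starF g x) :=
  starR_comp₂ (fun v : Fin 2 → ℕ => v 0 ≤ v 1) f g x

theorem starR_lt (f g : (Fin k → ℕ) → ℕ) (x : Fin k → M) :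
    starR (fun v => f v < g v) x ↔ lt (starF f x) (starF g x) :=
  starR_comp₂ (fun v : Fin 2 → ℕ => v 0 < v 1) f g x

/-- The name of equality on `ℕ` is interpreted in `M` as equality. -/
theorem starR_eq (f g : (Fin k → ℕ) → ℕ) (x : Fin k → M) :
    starR (fun v => f v = g v) x ↔ starF f x = starF g x := by
  have h := transfer (M := M) ((relFormula fun v => f v = g v).iff
      (Language.Term.equal (funTerm f) (funTerm g)))
    (fun v => by
      rw [Language.Formula.realize_iff, realize_relFormula, Language.Formula.realize_equal]
      rfl) x
  rw [Language.Formula.realize_iff, realize_relFormula, Language.Formula.realize_equal] at h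
  exact h

theorem starF_comp₁ (F : (Fin 1 → ℕ) → ℕ) (f : (Fin k → ℕ) → ℕ) (x : Fin k → M) :
    starF (fun v => F ![f v]) x = starF F ![starF f x] := by
  have h := starF_comp F ![f] x
  have e1 : (fun v => F fun i => (![f] : Fin 1 → (Fin k → ℕ) → ℕ) i v) = fun v => F ![f v] := by
    funext v; congr 1; funext i; fin_cases i; rfl
  have e2 : (fun i => starF ((![f] : Fin 1 → (Fin k → ℕ) → ℕ) i) x) = ![starF f x] := by
    funext i; fin_cases i; rfl
  rwa [e1, e2] at h

theorem starF_comp₃ (F : (Fin 3 → ℕ) → ℕ) (f g h : (Fin k → ℕ) → ℕ) (x : Fin k → M) :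
    starF (fun v => F ![f v, g v, h v]) x = starF F ![starF f x, starF g x, starF h x] := by
  have H := starF_comp F ![f, g, h] x
  have e1 : (fun v => F fun i => (![f, g, h] : Fin 3 → (Fin k → ℕ) → ℕ) i v) =
      fun v => F ![f v, g v, h v] := by
    funext v; congr 1; funext i; fin_cases i <;> rfl
  have e2 : (fun i => starF ((![f, g, h] : Fin 3 → (Fin k → ℕ) → ℕ) i) x) =
      ![starF f x, starF g x, starF h x] := by
    funext i; fin_cases i <;> rfl
  rwa [e1, e2] at H

theorem starR_comp₃ (R : (Fin 3 → ℕ) → Prop) (f g h : (Fin k → ℕ) → ℕ) (x : Fin k → M) :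
    starR (fun v => R ![f v, g v, h v]) x ↔ starR R ![starF f x, starF g x, starF h x] := by
  have H := starR_comp R ![f, g, h] x
  have e1 : (fun v => R fun i => (![f, g, h] : Fin 3 → (Fin k → ℕ) → ℕ) i v) =
      fun v => R ![f v, g v, h v] := by
    funext v; congr 1; funext i; fin_cases i <;> rfl
  have e2 : (fun i => starF ((![f, g, h] : Fin 3 → (Fin k → ℕ) → ℕ) i) x) =
      ![starF f x, starF g x, starF h x] := by
    funext i; fin_cases i <;> rfl
  rwa [e1, e2] at H

theorem starR_comp₄ (R : (Fin 4 → ℕ) → Prop) (f g h j : (Fin k → ℕ) → ℕ) (x : Fin k → M) :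
    starR (fun v => R ![f v, g v, h v, j v]) x ↔
      starR R ![starF f x, starF g x, starF h x, starF j x] := by
  have H := starR_comp R ![f, g, h, j] x
  have e1 : (fun v => R fun i => (![f, g, h, j] : Fin 4 → (Fin k → ℕ) → ℕ) i v) =
      fun v => R ![f v, g v, h v, j v] := by
    funext v; congr 1; funext i; fin_cases i <;> rfl
  have e2 : (fun i => starF ((![f, g, h, j] : Fin 4 → (Fin k → ℕ) → ℕ) i) x) =
      ![starF f x, starF g x, starF h x, starF j x] := by
    funext i; fin_cases i <;> rfl
  rwa [e1, e2] at H

/-- Every nonstandard number exceeds all standard ones. -/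
theorem IsNonstandard.std_le {x : M} (hx : IsNonstandard x) (N : ℕ) : le (std M N) x := by
  induction N with
  | zero =>
    have h := starR_of_forall (M := M) (R := fun v : Fin 1 → ℕ => 0 ≤ v 0)
      (fun v => Nat.zero_le _) ![x]
    simp only [starR_le, starF_proj, starF_const] at h
    exact h
  | succ N ih =>
    have h := starR_of_forall (M := M)
      (R := fun v : Fin 1 → ℕ => N ≤ v 0 → ¬ v 0 = N → N + 1 ≤ v 0) (fun v => by omega) ![x]
    simp only [starR_imp, starR_false, starR_le, starR_eq, starF_proj, starF_const] at h
    exact h ih (hx N)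

@[simp]
theorem decodeSet_codeSet (s : Finset ℕ) : decodeSet (codeSet s) = s := by
  simp [decodeSet, codeSet]

/-- A relation on tuples that is the prolongation of a standard one, with a parameter `p`, is
coded, if the standard relation has finitely many solutions for each value of the parameter. -/
theorem isCoded_of_finite {R : (Fin (k + 1) → ℕ) → Prop}
    (hR : ∀ p, {x : Fin k → ℕ | R (Fin.cons p x)}.Finite) (p : M) :
    IsCoded fun x : Fin k → M => starR R (Fin.cons p x : Fin (k + 1) → M) := by
  let c : (Fin 1 → ℕ) → ℕ := fun v => codeSet ((hR (v 0)).toFinset.image Encodable.encode)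
  refine ⟨starF c ![p], fun x => ?_⟩
  have h := starR_of_forall (M := M) (R := fun v : Fin (k + 1) → ℕ =>
      R v ↔ Encodable.encode (fun i : Fin k => v i.succ) ∈ decodeSet (c ![v 0]))
    (fun v => by
      have e : R v ↔ R (Fin.cons (v 0) fun i : Fin k => v i.succ) := by
        rw [show (Fin.cons (v 0) fun i : Fin k => v i.succ : Fin (k + 1) → ℕ) = v from
          Fin.cons_self_tail v]
      rw [e]
      simp [c]) (Fin.cons p x)
  simp only [starR_iff, starR_mem, starF_comp₁ c, starF_proj, Fin.cons_zero] at h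
  rw [starF_comp (fun v : Fin k → ℕ => Encodable.encode v)
    (fun (i : Fin k) (v : Fin (k + 1) → ℕ) => v i.succ)] at h
  simpa only [starF_proj, Fin.cons_succ] using h

end Transfer

/-! ### Internal random variables -/

section Internal

variable {M : Type*} [LAll.Structure M]

/-- A function on the samples is internal if it is a section of the prolongation of a standard
function; one parameter suffices, because tuples of parameters can be coded. -/
def IsInternal {S : M} (α : Sample S → M) : Prop :=
  ∃ (p : M) (g : (Fin 2 → ℕ) → ℕ), ∀ ω, α ω = starF g ![p, ω.1]

variable [M ⊨ LAll.completeTheory ℕ] {S : M}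

theorem isInternal_const (p : M) : IsInternal fun _ : Sample S => p :=
  ⟨p, fun v => v 0, fun ω => by rw [starF_proj]; rfl⟩

theorem isInternal_sample : IsInternal fun ω : Sample S => ω.1 :=
  ⟨S, fun v => v 1, fun ω => by rw [starF_proj]; rfl⟩

theorem IsInternal.comp {k : ℕ} {α : Fin k → Sample S → M} (hα : ∀ i, IsInternal (α i))
    (f : (Fin k → ℕ) → ℕ) : IsInternal fun ω => starF f fun i => α i ω := by
  choose p g h using hα
  let d : Fin k → (Fin 1 → ℕ) → ℕ := fun i v =>
    ((Encodable.decode (v 0) : Option (Fin k → ℕ)).getD 0) i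
  refine ⟨starF (fun v : Fin k → ℕ => Encodable.encode v) p,
    fun v => f fun i => g i ![d i ![v 0], v 1], fun ω => ?_⟩
  have hd : ∀ i, starF (d i) ![starF (fun v : Fin k → ℕ => Encodable.encode v) p] = p i := by
    intro i
    rw [← starF_comp₁ (d i) (fun v : Fin k → ℕ => Encodable.encode v), ← starF_proj i p]
    congr 1
    funext v
    simp [d]
  rw [starF_comp f (fun i (v : Fin 2 → ℕ) => g i ![d i ![v 0], v 1])]
  refine congrArg (starF f) (funext fun i => ?_)
  rw [starF_comp₂ (g i), starF_comp₁ (d i), starF_proj, starF_proj, h]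
  exact congrArg (fun a => starF (g i) ![a, ω.1]) (hd i).symm

/-- A standard relation between internal random variables defines an event. -/
theorem setOf_starR_mem_events {k : ℕ} (R : (Fin k → ℕ) → Prop) {α : Fin k → Sample S → M}
    (hα : ∀ i, IsInternal (α i)) : {ω | starR R fun i => α i ω} ∈ events S := by
  classical
  let χ : (Fin k → ℕ) → ℕ := fun v => if R v then 1 else 0
  obtain ⟨p, g, h⟩ := IsInternal.comp hα χ
  let c : (Fin 2 → ℕ) → ℕ := fun v => codeSet ((decodeSet (v 1)).filter fun x => g ![v 0, x] = 1)
  refine ⟨starF c ![p, S], fun ω => ?_⟩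
  have h1 := starR_of_forall (M := M) (R := fun v : Fin k → ℕ => R v ↔ χ v = 1)
    (fun v => by simp [χ]) (fun i => α i ω)
  have h2 := starR_of_forall (M := M) (R := fun v : Fin 3 → ℕ =>
      v 2 ∈ decodeSet (v 1) → (v 2 ∈ decodeSet (c ![v 0, v 1]) ↔ g ![v 0, v 2] = 1))
    (fun v hv => by simpa [c] using fun _ => hv) ![p, S, ω.1]
  simp only [starR_imp, starR_iff, starR_mem, starR_eq, starF_comp₂ c, starF_comp₂ g, starF_proj,
    starF_const] at h1 h2
  have h3 : starF χ (fun i => α i ω) = starF g ![p, ω.1] := h ω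
  rw [Set.mem_ofPred_eq, h1, h3]
  exact (h2 ω.2).symm

theorem setOf_eq_mem_events {α β : Sample S → M} (hα : IsInternal α) (hβ : IsInternal β) :
    {ω | α ω = β ω} ∈ events S := by
  have h := setOf_starR_mem_events (fun v : Fin 2 → ℕ => v 0 = v 1) (α := ![α, β])
    (fun i => by fin_cases i; exacts [hα, hβ])
  simp only [starR_eq, starF_proj] at h
  exact h

end Internal

/-! ### Truth values as classes of events -/

section TruthValues

variable {M : Type*} [LAll.Structure M] [M ⊨ LAll.completeTheory ℕ] {S : M}

theorem eventClass_inf (A B : events S) : eventClass (A ⊓ B) = eventClass A ⊓ eventClass B := by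
  rw [eventClass, toBoolRing_inf, map_mul, toBoolAlg_mul]
  rfl

theorem eventClass_compl (A : events S) : eventClass Aᶜ = (eventClass A)ᶜ := by
  have h : toBoolRing Aᶜ = 1 + toBoolRing A := by
    rw [← toBoolRing_top, ← toBoolRing_symmDiff, top_symmDiff, hnot_eq_compl]
  apply ofBoolAlg_inj.1
  rw [ofBoolAlg_compl, eventClass, h, map_add, map_one]
  rfl

theorem eventClass_sup (A B : events S) : eventClass (A ⊔ B) = eventClass A ⊔ eventClass B := by
  have h : A ⊔ B = (Aᶜ ⊓ Bᶜ)ᶜ := by simp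
  rw [h, eventClass_compl, eventClass_inf, eventClass_compl, eventClass_compl]
  simp

theorem eventClass_eq_bot {A : events S} : eventClass A = ⊥ ↔ IsNull A.1 := by
  rw [← toBoolAlg_zero, eventClass, toBoolAlg_inj, Ideal.Quotient.eq_zero_iff_mem]
  rfl

theorem eventClass_le {A B : events S} :
    eventClass A ≤ eventClass B ↔ IsNull (A.1 \ B.1) := by
  rw [← disjoint_compl_right_iff, disjoint_iff, ← eventClass_compl, ← eventClass_inf,
    eventClass_eq_bot]
  rfl

theorem eventClass_surjective (b : TruthValue S) : ∃ A : events S, eventClass A = b := by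
  obtain ⟨A, hA⟩ := Ideal.Quotient.mk_surjective (ofBoolAlg b)
  exact ⟨ofBoolRing A, by rw [eventClass, toBoolRing_ofBoolRing, hA, toBoolAlg_ofBoolAlg]⟩

theorem IsClassOf.not {P : Sample S → Prop} {b : TruthValue S} (h : IsClassOf P b) :
    IsClassOf (fun ω => ¬ P ω) bᶜ := by
  obtain ⟨hP, rfl⟩ := h
  exact ⟨BooleanSubalgebra.compl_mem hP, (eventClass_compl _).symm⟩

theorem IsClassOf.and {P Q : Sample S → Prop} {b c : TruthValue S} (hP : IsClassOf P b)
    (hQ : IsClassOf Q c) : IsClassOf (fun ω => P ω ∧ Q ω) (b ⊓ c) := by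
  obtain ⟨hP, rfl⟩ := hP
  obtain ⟨hQ, rfl⟩ := hQ
  exact ⟨BooleanSubalgebra.inf_mem hP hQ, (eventClass_inf _ _).symm⟩

theorem IsClassOf.or {P Q : Sample S → Prop} {b c : TruthValue S} (hP : IsClassOf P b)
    (hQ : IsClassOf Q c) : IsClassOf (fun ω => P ω ∨ Q ω) (b ⊔ c) := by
  obtain ⟨hP, rfl⟩ := hP
  obtain ⟨hQ, rfl⟩ := hQ
  exact ⟨BooleanSubalgebra.sup_mem hP hQ, (eventClass_sup _ _).symm⟩

theorem IsClassOf.eq_bot {P : Sample S → Prop} {b : TruthValue S} (h : IsClassOf P b)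
    (hP : IsNull {ω | P ω}) : b = ⊥ := by
  obtain ⟨h, rfl⟩ := h
  exact eventClass_eq_bot.2 hP

end TruthValues

/-! ### Completeness of the algebra of truth values -/

section Completeness

variable {M : Type*} [LAll.Structure M]

/-- Saturation, for the prolongations of countably many standard relations. -/
theorem IsAlephOneSaturated.exists_starR (hsat : IsAlephOneSaturated M)
    (R : ℕ → (Fin 3 → ℕ) → Prop) (p q : ℕ → M)
    (h : ∀ N, ∃ x, ∀ j < N, starR (R j) ![p j, q j, x]) :
    ∃ x, ∀ j, starR (R j) ![p j, q j, x] := by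
  let φ : ℕ → LAll.Formula (M ⊕ Unit) := fun j =>
    Language.Relations.formula (L := LAll) (n := 3) (R j)
      ![Language.Term.var (Sum.inl (p j)), Language.Term.var (Sum.inl (q j)),
        Language.Term.var (Sum.inr ())]
  have hφ : ∀ j x, (φ j).Realize (Sum.elim id fun _ => x) ↔ starR (R j) ![p j, q j, x] := by
    intro j x
    refine Language.Formula.realize_rel.trans (iff_of_eq (congrArg (starR (R j)) ?_))
    funext i
    fin_cases i <;> rfl
  obtain ⟨x, hx⟩ := hsat (Set.range φ) (Set.countable_range φ) (by
    intro Ψ hΨ hfin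
    obtain ⟨N, hN⟩ := (hfin.image (Function.invFun φ)).bddAbove
    obtain ⟨x, hx⟩ := h (N + 1)
    refine ⟨x, fun ψ hψ => ?_⟩
    rw [← Function.invFun_eq (hΨ hψ)]
    exact (hφ _ x).2 (hx _ (Nat.lt_succ_of_le (hN ⟨ψ, hψ, rfl⟩))))
  exact ⟨x, fun j => (hφ j x).1 (hx _ ⟨j, rfl⟩)⟩

/-- The relation `A ⊆ B` between codes of finite sets. -/
def subRel (v : Fin 2 → ℕ) : Prop := decodeSet (v 0) ⊆ decodeSet (v 1)

/-- The relation `k · |A| ≤ r · |B|` between codes of finite sets. -/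
def cardRel (k r : ℕ) (v : Fin 2 → ℕ) : Prop :=
  k * (decodeSet (v 0)).card ≤ r * (decodeSet (v 1)).card

theorem starR_cardRel_one {k : ℕ} {a b : M} : starR (cardRel k 1) ![a, b] ↔ cardLe k a b := by
  have e : cardRel k 1 = fun v => k * (decodeSet (v 0)).card ≤ (decodeSet (v 1)).card := by
    funext v
    rw [cardRel, one_mul]
  rw [e]
  rfl

variable [M ⊨ LAll.completeTheory ℕ] {S : M}

theorem starR_subRel {a b : M} : starR subRel ![a, b] ↔ ∀ x, mem x a → mem x b := by
  constructor
  · intro h x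
    have H := starR_of_forall (M := M) (R := fun v : Fin 3 → ℕ => subRel ![v 0, v 1] →
      v 2 ∈ decodeSet (v 0) → v 2 ∈ decodeSet (v 1)) (fun v hv => @hv (v 2)) ![a, b, x]
    simp only [starR_imp, starR_mem, starR_comp₂ subRel, starF_proj] at H
    exact H h
  · intro h
    -- an element of the difference, if there is one, is the value of a standard function
    let w : (Fin 2 → ℕ) → ℕ := fun v => sInf ↑(decodeSet (v 0) \ decodeSet (v 1))
    have H := starR_of_forall (M := M) (R := fun v : Fin 2 → ℕ =>
      (w ![v 0, v 1] ∈ decodeSet (v 0) → w ![v 0, v 1] ∈ decodeSet (v 1)) → subRel ![v 0, v 1])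
      (fun v hv => by
        by_contra hs
        have hne : (decodeSet (v 0) \ decodeSet (v 1)).Nonempty := Finset.sdiff_nonempty.2 hs
        have hw := Nat.sInf_mem (s := ↑(decodeSet (v 0) \ decodeSet (v 1))) hne
        rw [Finset.mem_coe, Finset.mem_sdiff] at hw
        exact hw.2 (hv hw.1)) ![a, b]
    simp only [starR_imp, starR_mem, starR_comp₂ subRel, starF_comp₂ w, starF_proj] at H
    exact H (h _)

/-- The elements of the set coded by `a` are the samples in the event `A`. -/
def Codes (a : M) (A : Set (Sample S)) : Prop :=
  ∀ x : M, mem x a ↔ ∃ h : mem x S, (⟨x, h⟩ : Sample S) ∈ A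

theorem exists_codes {A : Set (Sample S)} (hA : A ∈ events S) : ∃ a, Codes a A := by
  obtain ⟨a, ha⟩ := hA
  refine ⟨starF (setOp (· \ ·)) ![S, starF (setOp (· \ ·)) ![S, a] ], fun x => ?_⟩
  rw [mem_sdiff, mem_sdiff]
  constructor
  · rintro ⟨hx, h⟩
    exact ⟨hx, (ha ⟨x, hx⟩).2 (by tauto)⟩
  · rintro ⟨hx, h⟩
    exact ⟨hx, fun h' => h'.2 ((ha ⟨x, hx⟩).1 h)⟩

theorem Codes.sdiff {a b : M} {A B : Set (Sample S)} (ha : Codes a A) (hb : Codes b B) :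
    Codes (starF (setOp (· \ ·)) ![a, b]) (A \ B) := by
  intro x
  rw [mem_sdiff, ha, hb]
  constructor
  · rintro ⟨⟨hx, h⟩, h'⟩
    exact ⟨hx, h, fun h'' => h' ⟨hx, h''⟩⟩
  · rintro ⟨hx, h, h'⟩
    exact ⟨⟨hx, h⟩, fun ⟨_, h''⟩ => h' h''⟩

theorem Codes.union {a b : M} {A B : Set (Sample S)} (ha : Codes a A) (hb : Codes b B) :
    Codes (starF (setOp (· ∪ ·)) ![a, b]) (A ∪ B) := by
  intro x
  rw [mem_union, ha, hb, ← exists_or]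
  rfl

theorem Codes.subset {a : M} {A : Set (Sample S)} (ha : Codes a A) : starR subRel ![a, S] :=
  starR_subRel.2 fun x hx => ((ha x).1 hx).1

theorem setOp_union_apply (v : Fin 2 → ℕ) :
    decodeSet (setOp (· ∪ ·) v) = decodeSet (v 0) ∪ decodeSet (v 1) := decodeSet_codeSet _

theorem setOp_sdiff_apply (v : Fin 2 → ℕ) :
    decodeSet (setOp (· \ ·) v) = decodeSet (v 0) \ decodeSet (v 1) := decodeSet_codeSet _

/-- By saturation every set `s` of truth values has a supremum. Among the events whose class lies
below all upper bounds of `s`, choose for each `k` one, `A k`, whose measure is maximal up to an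
error of `1 / k`. A coded set that contains all of them, and whose measure exceeds that of `A k`
by at most `1 / k` for every `k`, represents the supremum. -/
theorem IsAlephOneSaturated.exists_isLUB (hsat : IsAlephOneSaturated M) (s : Set (TruthValue S)) :
    ∃ b, IsLUB s b := by
  classical
  let D : Set M := {a | ∃ A : events S, Codes a A.1 ∧ eventClass A ∈ lowerBounds (upperBounds s)}
  have hDS : ∀ a ∈ D, starR subRel ![a, S] := fun a ⟨A, hA, _⟩ => hA.subset
  have hunion : ∀ a ∈ D, ∀ b ∈ D, starF (setOp (· ∪ ·)) ![a, b] ∈ D := by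
    rintro a ⟨A, hA, hA'⟩ b ⟨B, hB, hB'⟩
    refine ⟨A ⊔ B, hA.union hB, fun d hd => ?_⟩
    rw [eventClass_sup]
    exact sup_le (hA' hd) (hB' hd)
  have hbot : ∃ a, a ∈ D := by
    obtain ⟨a, ha⟩ := exists_codes (⊥ : events S).2
    refine ⟨a, ⊥, ha, fun d _ => ?_⟩
    have h0 : eventClass (⊥ : events S) = ⊥ := by
      rw [eventClass, toBoolRing_bot, map_zero, toBoolAlg_zero]
    rw [h0]
    exact bot_le
  -- the largest `r ≤ k` such that some member of `D` has measure at least `r / k`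
  let r : ℕ → ℕ := fun k => Nat.findGreatest (fun r => ∃ a ∈ D, starR (cardRel r k) ![S, a]) k
  have hr : ∀ k, ∃ a ∈ D, starR (cardRel (r k) k) ![S, a] := by
    intro k
    refine Nat.findGreatest_spec (P := fun r => ∃ a ∈ D, starR (cardRel r k) ![S, a])
      (Nat.zero_le k) ?_
    obtain ⟨a, ha⟩ := hbot
    exact ⟨a, ha, starR_of_forall (fun v => by simp [cardRel]) _⟩
  choose a haD har using hr
  have hmax : ∀ k, ∀ b ∈ D, starR (cardRel k (r k + 1)) ![b, S] := by
    intro k b hb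
    rcases Nat.lt_or_ge (r k) k with hlt | hge
    · have h1 : ¬ starR (cardRel (r k + 1) k) ![S, b] := fun h =>
        Nat.findGreatest_is_greatest (P := fun r => ∃ a ∈ D, starR (cardRel r k) ![S, a])
          (Nat.lt_succ_self (r k)) hlt ⟨b, hb, h⟩
      have H := starR_of_forall (M := M) (R := fun v : Fin 2 → ℕ =>
        ¬ cardRel (r k + 1) k ![v 1, v 0] → cardRel k (r k + 1) ![v 0, v 1])
        (fun v hv => (not_le.1 hv).le) ![b, S]
      rw [starR_imp, starR_not] at H
      simp only [starR_comp₂ (cardRel _ _), starF_proj] at H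
      exact H h1
    · have H := starR_of_forall (M := M) (R := fun v : Fin 2 → ℕ =>
        subRel ![v 0, v 1] → cardRel k (r k + 1) ![v 0, v 1])
        (fun v hv => Nat.mul_le_mul (hge.trans (Nat.le_succ _)) (Finset.card_le_card hv)) ![b, S]
      simp only [starR_imp, starR_comp₂ subRel, starR_comp₂ (cardRel _ _), starF_proj] at H
      exact H (hDS b hb)
  have hfin : ∀ N, ∃ x ∈ D, ∀ j < N, starR subRel ![a j, x] := by
    intro N
    induction N with
    | zero => exact ⟨hbot.choose, hbot.choose_spec, fun j hj => absurd hj (Nat.not_lt_zero j)⟩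
    | succ N ih =>
      obtain ⟨x, hx, hj⟩ := ih
      refine ⟨_, hunion x hx (a N) (haD N), fun j hjN => starR_subRel.2 fun y hy => ?_⟩
      rw [mem_union]
      rcases Nat.lt_succ_iff_lt_or_eq.1 hjN with h | rfl
      · exact Or.inl (starR_subRel.1 (hj j h) y hy)
      · exact Or.inr hy
  have hand : ∀ j x, starR (fun v : Fin 3 → ℕ => subRel ![v 0, v 2] ∧ subRel ![v 2, v 1] ∧
      cardRel j (r j + 1) ![v 2, v 1]) ![a j, S, x] ↔ starR subRel ![a j, x] ∧
      starR subRel ![x, S] ∧ starR (cardRel j (r j + 1)) ![x, S] := by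
    intro j x
    simp only [starR_and, starR_comp₂ subRel, starR_comp₂ (cardRel _ _), starF_proj]
    rfl
  obtain ⟨c, hc⟩ := hsat.exists_starR (fun j v => subRel ![v 0, v 2] ∧ subRel ![v 2, v 1] ∧
      cardRel j (r j + 1) ![v 2, v 1]) a (fun _ => S) fun N => by
    obtain ⟨x, hx, hj⟩ := hfin N
    exact ⟨x, fun j hjN => (hand j x).2 ⟨hj j hjN, hDS x hx, hmax j x hx⟩⟩
  replace hc := fun j => (hand j c).1 (hc j)
  let C : events S := ⟨{ω | mem ω.1 c}, c, fun ω => Iff.rfl⟩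
  have hcC : Codes c C.1 := fun x =>
    ⟨fun h => ⟨starR_subRel.1 (hc 0).2.1 x h, h⟩, fun ⟨_, h⟩ => h⟩
  refine ⟨eventClass C, fun b hb => ?_, fun d hd => ?_⟩
  · obtain ⟨B, rfl⟩ := eventClass_surjective b
    obtain ⟨b, hbB⟩ := exists_codes B.2
    refine eventClass_le.2 ⟨_, hbB.sdiff hcC, fun k => ?_⟩
    have H := starR_of_forall (M := M) (R := fun v : Fin 4 → ℕ =>
      subRel ![v 0, v 2] → cardRel (r k) k ![v 3, v 0] →
      cardRel k (r k + 1) ![setOp (· ∪ ·) ![v 0, v 1], v 3] →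
      cardRel k 1 ![setOp (· \ ·) ![v 1, v 2], v 3]) (fun v h1 h2 h3 => by
        simp only [subRel, cardRel, Matrix.cons_val, setOp_union_apply, setOp_sdiff_apply]
          at h1 h2 h3 ⊢
        have h4 : (decodeSet (v 0)).card + (decodeSet (v 1) \ decodeSet (v 2)).card ≤
            (decodeSet (v 0) ∪ decodeSet (v 1)).card := by
          rw [← Finset.card_union_of_disjoint]
          · exact Finset.card_le_card (Finset.union_subset_union_right Finset.sdiff_subset)
          · exact Finset.disjoint_sdiff.mono_left h1
        nlinarith [Nat.mul_le_mul_left k h4]) ![a k, b, c, S]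
    simp only [starR_imp, starR_comp₂ subRel, starR_comp₂ (cardRel _ _),
      starF_comp₂ (setOp _), starF_proj] at H
    have H' := H (hc k).1 (har k) (hmax k _ (hunion _ (haD k) b ⟨B, hbB, fun d hd => hd hb⟩))
    exact starR_cardRel_one.1 H'
  · obtain ⟨B, rfl⟩ := eventClass_surjective d
    obtain ⟨d, hdB⟩ := exists_codes B.2
    refine eventClass_le.2 ⟨_, hcC.sdiff hdB, fun k => ?_⟩
    obtain ⟨A, hA, hA'⟩ := haD (2 * k)
    obtain ⟨e, he, hek⟩ := eventClass_le.1 (hA' hd)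
    have hsub : starR subRel ![starF (setOp (· \ ·)) ![a (2 * k), d], e] :=
      starR_subRel.2 fun x hx => (he x).2 ((hA.sdiff hdB x).1 hx)
    have H := starR_of_forall (M := M) (R := fun v : Fin 5 → ℕ =>
      subRel ![v 0, v 1] → cardRel (r (2 * k)) (2 * k) ![v 4, v 0] →
      cardRel (2 * k) (r (2 * k) + 1) ![v 1, v 4] →
      subRel ![setOp (· \ ·) ![v 0, v 2], v 3] → cardRel (2 * k) 1 ![v 3, v 4] →
      cardRel k 1 ![setOp (· \ ·) ![v 1, v 2], v 4]) (fun v h1 h2 h3 h4 h5 => by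
        simp only [subRel, cardRel, Matrix.cons_val, setOp_sdiff_apply] at h1 h2 h3 h4 h5 ⊢
        have h6 : (decodeSet (v 1) \ decodeSet (v 2)).card ≤
            (decodeSet (v 1) \ decodeSet (v 0)).card + (decodeSet (v 3)).card := by
          refine (Finset.card_le_card ?_).trans (Finset.card_union_le _ _)
          intro x hx
          have := @h4 x
          simp only [Finset.mem_union, Finset.mem_sdiff] at hx this ⊢
          tauto
        have h7 := Finset.card_sdiff_add_card_eq_card h1
        nlinarith [Nat.mul_le_mul_left k h6, Nat.mul_le_mul_left k h7.le]) ![a (2 * k), c, d, e, S]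
    simp only [starR_imp, starR_comp₂ subRel, starR_comp₂ (cardRel _ _),
      starF_comp₂ (setOp _), starF_proj] at H
    have H' := H (hc _).1 (har _) (hc _).2.2 hsub (starR_cardRel_one.2 (hek _))
    exact starR_cardRel_one.1 H'

theorem IsAlephOneSaturated.exists_isGLB (hsat : IsAlephOneSaturated M) (s : Set (TruthValue S)) :
    ∃ b, IsGLB s b := by
  obtain ⟨b, hb⟩ := hsat.exists_isLUB (lowerBounds s)
  exact ⟨b, isLUB_lowerBounds.1 hb⟩

end Completeness

/-! ### Decision trees rarely find collisions -/

namespace NbTree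

variable {k : ℕ}

/-- The set of labels of the inner nodes on the path determined by `f`. -/
def queries (f : Fin k → Fin k) : NbTree k → Finset (Fin k)
  | leaf _ => ∅
  | node v child => insert v ((child (f v)).queries f)

/-- The tree that runs `T` and then, from a leaf labeled `m`, the tree `g m`. -/
def bind (g : ℕ → NbTree k) : NbTree k → NbTree k
  | leaf m => g m
  | node v child => node v fun u => (child u).bind g

theorem queries_bind (f : Fin k → Fin k) (g : ℕ → NbTree k) (T : NbTree k) :
    (T.bind g).queries f = T.queries f ∪ (g (T.output f)).queries f := by
  induction T with
  | leaf m => simp [bind, queries, output]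
  | node v c ih => simp [bind, queries, output, ih, Finset.insert_union]

theorem depth_bind_le (g : ℕ → NbTree k) (T : NbTree k) {d : ℕ} (hg : ∀ m, (g m).depth ≤ d) :
    (T.bind g).depth ≤ T.depth + d := by
  induction T with
  | leaf m => simpa [bind, depth] using hg m
  | node v c ih =>
    simp only [bind, depth, add_assoc]
    refine Nat.add_le_add_left (Finset.sup_le fun u _ => (ih u).trans ?_) 1
    exact Nat.add_le_add_right (Finset.le_sup (f := fun u => (c u).depth) (Finset.mem_univ u)) d

/-- The maps into `{0, …, h - 1}` that agree with `σ` on `D`. -/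
def extensions (h : ℕ) (D : Finset (Fin k)) (σ : Fin k → Fin k) : Finset (Fin k → Fin k) :=
  Fintype.piFinset fun i => if i ∈ D then {σ i} else Finset.univ.filter fun u => (u : ℕ) < h

theorem mem_extensions {h : ℕ} {D : Finset (Fin k)} {σ f : Fin k → Fin k} :
    f ∈ extensions h D σ ↔ (∀ i ∈ D, f i = σ i) ∧ ∀ i ∉ D, (f i : ℕ) < h := by
  simp only [extensions, Fintype.mem_piFinset]
  constructor
  · intro H
    exact ⟨fun i hi => by simpa [hi] using H i, fun i hi => by simpa [hi] using H i⟩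
  · rintro ⟨h1, h2⟩ i
    by_cases hi : i ∈ D
    · simpa [hi] using h1 i hi
    · simpa [hi] using h2 i hi

theorem card_filter_val_lt {h : ℕ} (hk : h ≤ k) :
    (Finset.univ.filter fun u : Fin k => (u : ℕ) < h).card = h := by
  rw [Fin.card_filter_val_lt, min_eq_right hk]

theorem card_extensions {h : ℕ} (hk : h ≤ k) (D : Finset (Fin k)) (σ : Fin k → Fin k) :
    (extensions h D σ).card = h ^ Dᶜ.card := by
  rw [extensions, Fintype.card_piFinset, ← Finset.prod_mul_prod_compl D]
  rw [Finset.prod_eq_one fun i hi => by simp [hi], one_mul]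
  rw [Finset.prod_congr rfl fun i hi => by
    rw [if_neg (Finset.mem_compl.1 hi), card_filter_val_lt hk], Finset.prod_const]

theorem card_extensions_insert {h : ℕ} (hk : h ≤ k) {D : Finset (Fin k)} {v : Fin k} (hv : v ∉ D)
    (σ τ : Fin k → Fin k) :
    h * (extensions h (insert v D) τ).card = (extensions h D σ).card := by
  rw [card_extensions hk, card_extensions hk, ← pow_succ', Finset.compl_insert,
    Finset.card_erase_add_one (Finset.mem_compl.2 hv)]

theorem mem_extensions_insert {h : ℕ} {D : Finset (Fin k)} {σ f : Fin k → Fin k} {v : Fin k}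
    (hv : v ∉ D) (hf : f ∈ extensions h D σ) :
    f ∈ extensions h (insert v D) (Function.update σ v (f v)) := by
  rw [mem_extensions] at hf ⊢
  refine ⟨fun i hi => ?_, fun i hi => hf.2 i fun h => hi (Finset.mem_insert_of_mem h)⟩
  rcases Finset.mem_insert.1 hi with rfl | hiD
  · simp
  · rw [Function.update_of_ne (by rintro rfl; exact hv hiD), hf.1 i hiD]

/-- Suppose that the values on `D` of a random map into `h` points are known, and pairwise
distinct. Then a tree of depth `d` finds two points with the same value with probability at most
`d (|D| + d) / h`: each new query hits an earlier value with probability at most `(|D| + d) / h`. -/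
theorem card_collision_extensions_le {h : ℕ} (hk : h ≤ k) (T : NbTree k) :
    ∀ (d : ℕ) (D : Finset (Fin k)) (σ : Fin k → Fin k), T.depth ≤ d → Set.InjOn σ D →
      h * ((extensions h D σ).filter fun f => ¬ Set.InjOn f ↑(D ∪ T.queries f)).card ≤
        d * (D.card + d) * (extensions h D σ).card := by
  induction T with
  | leaf m =>
    intro d D σ _ hσ
    rw [Finset.filter_false_of_mem, Finset.card_empty, mul_zero]
    · exact Nat.zero_le _
    · intro f hf
      rw [not_not, queries, Finset.union_empty]
      exact hσ.congr fun i hi => ((mem_extensions.1 hf).1 i hi).symm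
  | node v c ih =>
    intro d D σ hd hσ
    obtain ⟨d, rfl⟩ : ∃ e, d = e + 1 := ⟨d - 1, by simp only [depth] at hd; omega⟩
    have hdu : ∀ u, (c u).depth ≤ d := fun u => by
      have := Finset.le_sup (f := fun u => (c u).depth) (Finset.mem_univ u)
      simp only [depth] at hd
      omega
    by_cases hv : v ∈ D
    · have e : ((extensions h D σ).filter
          fun f => ¬ Set.InjOn f ↑(D ∪ (node v c).queries f)) =
          (extensions h D σ).filter fun f => ¬ Set.InjOn f ↑(D ∪ (c (σ v)).queries f) := by
        refine Finset.filter_congr fun f hf => ?_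
        rw [queries, (mem_extensions.1 hf).1 v hv, Finset.union_insert,
          Finset.insert_eq_of_mem (Finset.mem_union_left _ hv)]
      rw [e]
      refine (ih (σ v) d D σ (hdu _) hσ).trans (Nat.mul_le_mul_right _ ?_)
      exact Nat.mul_le_mul (Nat.le_succ d) (Nat.add_le_add_left (Nat.le_succ d) _)
    · set N := (extensions h (insert v D) σ).card with hN
      have hNu : ∀ u, (extensions h (insert v D) (Function.update σ v u)).card = N := fun u => by
        rw [hN, card_extensions hk, card_extensions hk]
      -- the value of the new query is either an old value, or the search goes on without collision
      have hsub : ((extensions h D σ).filter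
          fun f => ¬ Set.InjOn f ↑(D ∪ (node v c).queries f)) ⊆
          ((D.image σ).biUnion fun u => extensions h (insert v D) (Function.update σ v u)) ∪
          ((Finset.univ.filter fun u : Fin k => (u : ℕ) < h) \ D.image σ).biUnion fun u =>
            (extensions h (insert v D) (Function.update σ v u)).filter
              fun f => ¬ Set.InjOn f ↑(insert v D ∪ (c u).queries f) := by
        intro f hf
        obtain ⟨hf, hc⟩ := Finset.mem_filter.1 hf
        have hf' := mem_extensions_insert hv hf
        by_cases hu : f v ∈ D.image σ
        · exact Finset.mem_union_left _ (Finset.mem_biUnion.2 ⟨f v, hu, hf'⟩)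
        · refine Finset.mem_union_right _ (Finset.mem_biUnion.2 ⟨f v, ?_, ?_⟩)
          · simp only [Finset.mem_sdiff, Finset.mem_filter, Finset.mem_univ, true_and]
            exact ⟨(mem_extensions.1 hf).2 v hv, hu⟩
          · refine Finset.mem_filter.2 ⟨hf', ?_⟩
            rwa [queries, Finset.union_insert, ← Finset.insert_union] at hc
      have h1 : (((D.image σ).biUnion fun u =>
          extensions h (insert v D) (Function.update σ v u))).card ≤ D.card * N := by
        refine Finset.card_biUnion_le.trans ?_
        simp only [hNu, Finset.sum_const, smul_eq_mul]
        exact Nat.mul_le_mul_right _ Finset.card_image_le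
      have h2 : h * ((((Finset.univ.filter fun u : Fin k => (u : ℕ) < h) \ D.image σ).biUnion
          fun u => (extensions h (insert v D) (Function.update σ v u)).filter
              fun f => ¬ Set.InjOn f ↑(insert v D ∪ (c u).queries f))).card ≤
          h * (d * (D.card + 1 + d) * N) := by
        refine (Nat.mul_le_mul_left h Finset.card_biUnion_le).trans ?_
        rw [Finset.mul_sum]
        refine (Finset.sum_le_card_nsmul _ _ (d * (D.card + 1 + d) * N) fun u hu => ?_).trans ?_
        · have hinj : Set.InjOn (Function.update σ v u) ↑(insert v D) := by
            have hu' := (Finset.mem_sdiff.1 hu).2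
            have heq : Set.EqOn σ (Function.update σ v u) D := fun i hi =>
              (Function.update_of_ne (by rintro rfl; exact hv hi) _ _).symm
            rw [Finset.coe_insert, Set.injOn_insert (by simpa using hv)]
            refine ⟨hσ.congr heq, ?_⟩
            rw [Function.update_self, ← heq.image_eq, ← Finset.coe_image]
            exact hu'
          have := ih u d (insert v D) _ (hdu u) hinj
          rwa [Finset.card_insert_of_notMem hv, hNu] at this
        · rw [smul_eq_mul]
          refine Nat.mul_le_mul_right _ ((Finset.card_le_card Finset.sdiff_subset).trans ?_)
          rw [card_filter_val_lt hk]
      have h3 := Nat.mul_le_mul_left h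
        ((Finset.card_le_card hsub).trans (Finset.card_union_le _ _))
      have h4 := Nat.mul_le_mul_left h h1
      rw [mul_add] at h3
      refine (h3.trans (Nat.add_le_add h4 h2)).trans ?_
      rw [← card_extensions_insert hk hv σ σ, ← hN]
      have h5 : D.card + d * (D.card + 1 + d) ≤ (d + 1) * (D.card + (d + 1)) := by nlinarith
      nlinarith [Nat.mul_le_mul_right (h * N) h5]

/-- The tree that asks for the value at `x`, if `x < k`. -/
def ask (x : ℕ) : NbTree k :=
  if h : x < k then node ⟨x, h⟩ fun _ => leaf 0 else leaf 0

theorem depth_ask_le (x : ℕ) : (ask x : NbTree k).depth ≤ 1 := by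
  rw [ask]
  split_ifs
  · simp [depth]
  · simp [depth]

theorem mem_queries_ask (f : Fin k → Fin k) (x : Fin k) : x ∈ (ask (x : ℕ)).queries f := by
  simp [ask, queries]

/-- Two trees of depth at most `d₁` and `d₂` output two distinct points with the same value with
probability at most `(d₁ + d₂ + 2)² / h`. -/
theorem card_output_collision_le {h d₁ d₂ : ℕ} (hk : h ≤ k) (T₁ T₂ : NbTree k)
    (h₁ : T₁.depth ≤ d₁) (h₂ : T₂.depth ≤ d₂) :
    h * (((Finset.univ.filter fun f : Fin k → Fin k => ∀ i, (f i : ℕ) < h)).filter fun f =>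
        ∃ x y : Fin k, x ≠ y ∧ f x = f y ∧ T₁.output f = x ∧ T₂.output f = y).card ≤
      (d₁ + d₂ + 2) ^ 2 * (Finset.univ.filter fun f : Fin k → Fin k => ∀ i, (f i : ℕ) < h).card := by
  classical
  rcases isEmpty_or_nonempty (Fin k) with hempty | ⟨⟨i₀⟩⟩
  · rw [Finset.card_eq_zero.2 (Finset.filter_false_of_mem fun f _ => fun ⟨x, _⟩ => hempty.elim x),
      mul_zero]
    exact Nat.zero_le _
  have e : (Finset.univ.filter fun f : Fin k → Fin k => ∀ i, (f i : ℕ) < h) =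
      extensions h ∅ fun _ => i₀ := by
    ext f
    simp [mem_extensions]
  -- after running both trees, the combined tree asks for the values at the two outputs
  let T : NbTree k := T₁.bind fun x => T₂.bind fun y => (ask x).bind fun _ => ask y
  have hT : T.depth ≤ d₁ + d₂ + 2 := by
    have h3 : ∀ x y, ((ask x).bind fun _ => ask y : NbTree k).depth ≤ 2 := fun x y =>
      (depth_bind_le _ _ fun _ => depth_ask_le y).trans (Nat.add_le_add_right (depth_ask_le x) 1)
    refine (depth_bind_le (d := d₂ + 2) _ _ fun x => ?_).trans (by omega)
    exact (depth_bind_le _ _ fun y => h3 x y).trans (by omega)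
  have H := card_collision_extensions_le hk T (d₁ + d₂ + 2) ∅ (fun _ => i₀) hT (by simp)
  rw [Finset.card_empty, zero_add, ← pow_two, ← e] at H
  refine le_trans (Nat.mul_le_mul_left h (Finset.card_le_card ?_)) H
  refine Finset.monotone_filter_right _ ?_
  rintro f _ ⟨x, y, hxy, hf, hx, hy⟩ hinj
  refine hxy (hinj ?_ ?_ hf)
  · simp [T, queries_bind, hx, mem_queries_ask]
  · simp [T, queries_bind, hy, mem_queries_ask]

end NbTree

/-! ### Graphs of maps and outputs of trees, as standard functions of codes -/

section Standard

theorem pair_mem_graphCode {k : ℕ} {f : Fin k → Fin k} {x y : ℕ} :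
    Nat.pair x y ∈ decodeSet (graphCode f) ↔ ∃ h : x < k, (f ⟨x, h⟩ : ℕ) = y := by
  simp only [graphCode, decodeSet_codeSet, Finset.mem_image, Finset.mem_univ, true_and,
    Nat.pair_eq_pair]
  constructor
  · rintro ⟨i, rfl, rfl⟩
    exact ⟨i.2, rfl⟩
  · rintro ⟨h, rfl⟩
    exact ⟨⟨x, h⟩, rfl, rfl⟩

theorem graphCode_injective {k : ℕ} : Function.Injective (graphCode (k := k)) := by
  intro f g h
  funext i
  obtain ⟨_, hi⟩ := pair_mem_graphCode.1 (h ▸ pair_mem_graphCode.2 ⟨i.2, rfl⟩ :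
    Nat.pair i (f i) ∈ decodeSet (graphCode g))
  exact Fin.ext hi.symm

theorem mem_mapGraphs {k ω : ℕ} :
    ω ∈ decodeSet (mapGraphs k) ↔
      ∃ f : Fin k → Fin k, (∀ i, (f i : ℕ) < k / 2) ∧ graphCode f = ω := by
  simp [mapGraphs]

/-- The code of the space of samples, as a standard function. -/
def sampleCode (v : Fin 1 → ℕ) : ℕ := mapGraphs (v 0)

/-- `(k, T, ω, y)` such that the tree coded by `T` outputs `y` on the map with graph `ω`. -/
def outRel (v : Fin 4 → ℕ) : Prop :=
  ∃ (T : NbTree (v 0)) (f : Fin (v 0) → Fin (v 0)),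
    T.code = v 1 ∧ graphCode f = v 2 ∧ T.output f = v 3

/-- The output of the tree coded by `T` on the map with graph `ω`, as a function of `(k, T, ω)`. -/
noncomputable def outFun (v : Fin 3 → ℕ) : ℕ := sInf {y | outRel ![v 0, v 1, v 2, y]}

/-- The codes of the tree and of the map determine them, so the output is unique. -/
theorem outFun_of_outRel {k T ω y : ℕ} (h : outRel ![k, T, ω, y]) : outFun ![k, T, ω] = y := by
  have hs : {z | outRel ![k, T, ω, z]} = {y} := by
    ext z
    refine ⟨?_, fun hz => hz ▸ h⟩
    rintro ⟨T', f', hT', hf', hz⟩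
    obtain ⟨T, f, hT, hf, hy⟩ := h
    have eT : T = T' := NbTree.code_injective (hT.trans hT'.symm)
    have ef : f = f' := graphCode_injective (hf.trans hf'.symm)
    subst eT ef
    exact hz.symm.trans hy
  rw [outFun]
  exact (congrArg sInf hs).trans (csInf_singleton _)

/-- The value at `x` of the map with graph `ω`, as a function of `(ω, x)`. -/
noncomputable def evalFun (v : Fin 2 → ℕ) : ℕ := sInf {y | Nat.pair (v 1) y ∈ decodeSet (v 0)}

theorem evalFun_graphCode {k : ℕ} (f : Fin k → Fin k) (x : Fin k) :
    evalFun ![graphCode f, x] = f x := by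
  have hs : {y | Nat.pair x y ∈ decodeSet (graphCode f)} = {(f x : ℕ)} := by
    ext y
    change Nat.pair x y ∈ decodeSet (graphCode f) ↔ y = f x
    rw [pair_mem_graphCode]
    exact ⟨fun ⟨_, h⟩ => h.symm, fun h => ⟨x.2, h.symm⟩⟩
  exact (congrArg sInf hs).trans (csInf_singleton _)

/-- The function `evalFun`, with the value `0` outside the domain `{0, …, k - 1}`. -/
noncomputable def applyFun (v : Fin 3 → ℕ) : ℕ := if v 2 < v 0 then evalFun ![v 1, v 2] else 0

/-- `n ^ (1 / t)`, rounded. -/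
noncomputable def rootFun (v : Fin 2 → ℕ) : ℕ := (round ((v 0 : ℝ) ^ (1 / (v 1 : ℝ)))).toNat

/-- `(k, T, d)` such that `T` codes a tree of depth at most `d`. -/
def depthRel (v : Fin 3 → ℕ) : Prop := ∃ T : NbTree (v 0), T.code = v 1 ∧ T.depth ≤ v 2

/-- `(k, T, m)` such that `m` labels a leaf of the tree coded by `T`. -/
def leafRel (v : Fin 3 → ℕ) : Prop := ∃ T : NbTree (v 0), T.code = v 1 ∧ v 2 ∈ T.leafLabels

/-- The code of the tree that asks for the value at `i` and outputs it. -/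
noncomputable def askCode (v : Fin 2 → ℕ) : ℕ :=
  if h : v 1 < v 0 then (NbTree.node ⟨v 1, h⟩ fun u => .leaf u : NbTree (v 0)).code else 0

theorem askCode_of_lt {k i : ℕ} (h : i < k) :
    askCode ![k, i] = (NbTree.node ⟨i, h⟩ fun u => .leaf u : NbTree k).code := dif_pos h

/-- The graphs of maps on which the trees coded by `T₁` and `T₂` output two distinct points with
the same value. -/
noncomputable def collisionCode (v : Fin 3 → ℕ) : ℕ :=
  open Classical in
  codeSet ((decodeSet (mapGraphs (v 0))).filter fun ω =>
    outFun ![v 0, v 1, ω] < v 0 ∧ outFun ![v 0, v 2, ω] < v 0 ∧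
    outFun ![v 0, v 1, ω] ≠ outFun ![v 0, v 2, ω] ∧
    evalFun ![ω, outFun ![v 0, v 1, ω] ] = evalFun ![ω, outFun ![v 0, v 2, ω] ])

theorem mem_collisionCode {n c₁ c₂ ω : ℕ} :
    ω ∈ decodeSet (collisionCode ![n, c₁, c₂]) ↔ ω ∈ decodeSet (mapGraphs n) ∧
      outFun ![n, c₁, ω] < n ∧ outFun ![n, c₂, ω] < n ∧
      outFun ![n, c₁, ω] ≠ outFun ![n, c₂, ω] ∧
      evalFun ![ω, outFun ![n, c₁, ω] ] = evalFun ![ω, outFun ![n, c₂, ω] ] := by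
  rw [collisionCode, decodeSet_codeSet, Finset.mem_filter]
  rfl

theorem card_collisionCode_le {n c₁ c₂ d₁ d₂ : ℕ} (h₁ : depthRel ![n, c₁, d₁])
    (h₂ : depthRel ![n, c₂, d₂]) :
    (n / 2) * (decodeSet (collisionCode ![n, c₁, c₂])).card ≤
      (d₁ + d₂ + 2) ^ 2 * (decodeSet (mapGraphs n)).card := by
  classical
  obtain ⟨T₁, rfl, h₁⟩ : ∃ T : NbTree n, T.code = c₁ ∧ T.depth ≤ d₁ := h₁
  obtain ⟨T₂, rfl, h₂⟩ : ∃ T : NbTree n, T.code = c₂ ∧ T.depth ≤ d₂ := h₂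
  have H := NbTree.card_output_collision_le (Nat.div_le_self n 2) T₁ T₂ h₁ h₂
  rw [mapGraphs, decodeSet_codeSet, Finset.card_image_of_injective _ graphCode_injective]
  refine le_trans (Nat.mul_le_mul_left _ ?_) H
  rw [← Finset.card_image_of_injective _ graphCode_injective]
  refine Finset.card_le_card fun ω hω => ?_
  obtain ⟨hω, hx, hy, hxy, he⟩ := mem_collisionCode.1 hω
  obtain ⟨f, hf, rfl⟩ := mem_mapGraphs.1 hω
  have e₁ : outFun ![n, T₁.code, graphCode f] = T₁.output f :=
    outFun_of_outRel ⟨T₁, f, rfl, rfl, rfl⟩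
  have e₂ : outFun ![n, T₂.code, graphCode f] = T₂.output f :=
    outFun_of_outRel ⟨T₂, f, rfl, rfl, rfl⟩
  rw [e₁] at hx hxy he
  rw [e₂] at hy hxy he
  have hx' := evalFun_graphCode f ⟨_, hx⟩
  have hy' := evalFun_graphCode f ⟨_, hy⟩
  refine Finset.mem_image.2 ⟨f, Finset.mem_filter.2 ⟨by simpa using hf,
    ⟨_, hx⟩, ⟨_, hy⟩, fun h => hxy (congrArg Fin.val h), Fin.ext ?_, rfl, rfl⟩, rfl⟩
  exact hx'.symm.trans (he.trans hy')

/-! ### Growth of the rounded roots -/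

theorem one_le_rootFun {n t : ℕ} (hn : 1 ≤ n) : 1 ≤ rootFun ![n, t] := by
  have h1 : (1 : ℝ) ≤ (n : ℝ) ^ (1 / (t : ℝ)) :=
    Real.one_le_rpow (by exact_mod_cast hn) (by positivity)
  have h2 : (1 : ℤ) ≤ round ((n : ℝ) ^ (1 / (t : ℝ))) := by
    rw [round_eq, Int.le_floor]
    push_cast
    linarith
  simp only [rootFun, Matrix.cons_val]
  omega

theorem rootFun_le {n t : ℕ} (hn : 1 ≤ n) (ht : 4 ≤ t) :
    (rootFun ![n, t] : ℝ) ≤ (n : ℝ) ^ (1 / 4 : ℝ) + 1 / 2 := by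
  have h1 : (n : ℝ) ^ (1 / (t : ℝ)) ≤ (n : ℝ) ^ (1 / 4 : ℝ) :=
    Real.rpow_le_rpow_of_exponent_le (by exact_mod_cast hn)
      (one_div_le_one_div_of_le (by norm_num) (by exact_mod_cast ht))
  have h0 : (0 : ℝ) ≤ (n : ℝ) ^ (1 / (t : ℝ)) := by positivity
  have h2 : (0 : ℤ) ≤ round ((n : ℝ) ^ (1 / (t : ℝ))) := by
    rw [round_eq, Int.le_floor]
    push_cast
    linarith
  have h3 : ((rootFun ![n, t] : ℤ) : ℝ) = round ((n : ℝ) ^ (1 / (t : ℝ))) := by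
    simp only [rootFun, Matrix.cons_val, Int.toNat_of_nonneg h2]
  have h4 := Int.floor_le ((n : ℝ) ^ (1 / (t : ℝ)) + 1 / 2)
  rw [← round_eq, ← h3] at h4
  push_cast at h4
  linarith

/-- The square of the number of queries is negligible with respect to `n`. -/
theorem mul_rootFun_sq_le {K n t₁ t₂ : ℕ} (hn : (100 * K + 100) ^ 2 ≤ n) (h₁ : 4 ≤ t₁)
    (h₂ : 4 ≤ t₂) : K * (rootFun ![n, t₁] + rootFun ![n, t₂] + 2) ^ 2 ≤ n / 2 := by
  have hn1 : 1 ≤ n := le_trans (Nat.one_le_pow _ _ (by omega)) hn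
  have a₁ := rootFun_le hn1 h₁
  have a₂ := rootFun_le hn1 h₂
  set r : ℝ := (n : ℝ) ^ (1 / 4 : ℝ) with hr
  have hr1 : 1 ≤ r := Real.one_le_rpow (by exact_mod_cast hn1) (by norm_num)
  have hr4 : r ^ 4 = n := by
    rw [hr, ← Real.rpow_natCast, ← Real.rpow_mul (by positivity)]
    norm_num
  have hK : 100 * (K : ℝ) + 100 ≤ r ^ 2 := by
    have h : (100 * (K : ℝ) + 100) ^ 2 ≤ (r ^ 2) ^ 2 := by
      rw [← pow_mul, hr4]
      exact_mod_cast hn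
    exact le_of_sq_le_sq h (by positivity)
  -- there are at most `5 n ^ (1 / 4)` queries, so that `K` times their square is at most `25 K √n`
  have hq : ((rootFun ![n, t₁] : ℝ) + rootFun ![n, t₂] + 2) ^ 2 ≤ 25 * r ^ 2 := by
    have h5 : (rootFun ![n, t₁] : ℝ) + rootFun ![n, t₂] + 2 ≤ 5 * r := by linarith
    calc _ ≤ (5 * r) ^ 2 := pow_le_pow_left₀ (by positivity) h5 2
      _ = 25 * r ^ 2 := by ring
  have hfin : (2 * (K * (rootFun ![n, t₁] + rootFun ![n, t₂] + 2) ^ 2) : ℝ) ≤ n := by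
    rw [← hr4]
    have hKq := mul_le_mul_of_nonneg_left hq (Nat.cast_nonneg (α := ℝ) K)
    nlinarith [mul_le_mul_of_nonneg_right hK (sq_nonneg r), sq_nonneg r]
  have hfin' : 2 * (K * (rootFun ![n, t₁] + rootFun ![n, t₂] + 2) ^ 2) ≤ n := by
    exact_mod_cast hfin
  omega

theorem mul_card_collisionCode_le {K n c₁ c₂ t₁ t₂ : ℕ} (hn : (100 * K + 100) ^ 2 ≤ n)
    (ht₁ : 4 ≤ t₁) (ht₂ : 4 ≤ t₂) (h₁ : depthRel ![n, c₁, rootFun ![n, t₁] ])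
    (h₂ : depthRel ![n, c₂, rootFun ![n, t₂] ]) :
    K * (decodeSet (collisionCode ![n, c₁, c₂])).card ≤ (decodeSet (mapGraphs n)).card := by
  have h := card_collisionCode_le h₁ h₂
  have h' := mul_rootFun_sq_le hn ht₁ ht₂
  set q := (rootFun ![n, t₁] + rootFun ![n, t₂] + 2) ^ 2 with hq
  have hq0 : 0 < q := by positivity
  refine Nat.le_of_mul_le_mul_left ?_ hq0
  calc q * (K * (decodeSet (collisionCode ![n, c₁, c₂])).card)
      = K * q * (decodeSet (collisionCode ![n, c₁, c₂])).card := by ring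
    _ ≤ _ := (Nat.mul_le_mul_right _ h').trans h

/-- A `t` that tends to infinity with `n` so slowly that `n ≤ 2 ^ (n ^ (1 / t))`. -/
noncomputable def slowFun (v : Fin 1 → ℕ) : ℕ :=
  Nat.findGreatest (fun t => v 0 ≤ 2 ^ rootFun ![v 0, t]) (v 0)

/-- The bound holds for `t = 1`, so the greatest `t` searched for by `slowFun` satisfies it. -/
theorem le_two_pow_rootFun_slowFun {n : ℕ} (hn : 1 ≤ n) : n ≤ 2 ^ rootFun ![n, slowFun ![n] ] := by
  refine Nat.findGreatest_spec (P := fun t => n ≤ 2 ^ rootFun ![n, t]) hn ?_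
  have e : rootFun ![n, 1] = n := by simp [rootFun]
  rw [e]
  exact Nat.lt_two_pow_self.le

theorem eventually_le_slowFun (k : ℕ) : ∃ N, ∀ n, N ≤ n → k ≤ slowFun ![n] := by
  rcases Nat.eq_zero_or_pos k with rfl | hk
  · exact ⟨0, fun n _ => Nat.zero_le _⟩
  have hr : (0 : ℝ) < 1 / (k : ℝ) := by positivity
  have h := ((isLittleO_log_rpow_atTop hr).bound (show (0 : ℝ) < 1 / 4 by norm_num))
  obtain ⟨N, hN⟩ := Filter.eventually_atTop.1 (tendsto_natCast_atTop_atTop.eventually h)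
  refine ⟨N + k, fun n hn => Nat.le_findGreatest (by simp; omega) ?_⟩
  have hlog := hN n (by omega)
  have hn1 : (1 : ℝ) ≤ n := by exact_mod_cast (by omega : 1 ≤ n)
  have hx1 : (1 : ℝ) ≤ (n : ℝ) ^ (1 / (k : ℝ)) := Real.one_le_rpow hn1 hr.le
  rw [Real.norm_of_nonneg (Real.log_nonneg hn1), Real.norm_of_nonneg (by linarith)] at hlog
  have h2 : (n : ℝ) ^ (1 / (k : ℝ)) - 1 / 2 ≤ (rootFun ![n, k] : ℝ) := by
    have h3 := Int.lt_floor_add_one ((n : ℝ) ^ (1 / (k : ℝ)) + 1 / 2)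
    rw [← round_eq] at h3
    have h4 : (round ((n : ℝ) ^ (1 / (k : ℝ))) : ℝ) ≤ (rootFun ![n, k] : ℝ) := by
      exact_mod_cast Int.self_le_toNat _
    linarith
  have h5 : Real.log n ≤ rootFun ![n, k] * Real.log 2 := by
    nlinarith [Real.log_two_gt_d9]
  have h6 : (n : ℝ) ≤ 2 ^ rootFun ![n, k] := by
    rw [← Real.log_pow] at h5
    exact (Real.log_le_log_iff (by linarith) (by positivity)).1 h5
  simpa using (by exact_mod_cast h6 : n ≤ 2 ^ rootFun ![n, k])

end Standard

section Model

variable {M : Type*} [LAll.Structure M] [M ⊨ LAll.completeTheory ℕ] {n : M}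

/-! ### The cut and the random variables in `F_nb` -/

theorem le.trans {x y z : M} (h₁ : le x y) (h₂ : le y z) : le x z := by
  have H := starR_of_forall (M := M) (R := fun v : Fin 3 → ℕ =>
    v 0 ≤ v 1 → v 1 ≤ v 2 → v 0 ≤ v 2) (fun v => le_trans) ![x, y, z]
  simp only [starR_imp, starR_le, starF_proj] at H
  exact H h₁ h₂

theorem lt.le {x y : M} (h : lt x y) : le x y := by
  have H := starR_of_forall (M := M) (R := fun v : Fin 2 → ℕ => v 0 < v 1 → v 0 ≤ v 1)
    (fun v => Nat.le_of_lt) ![x, y]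
  simp only [starR_imp, starR_le, starR_lt, starF_proj] at H
  exact H h

theorem mem_cut_of_le {x y : M} (h : le x y) (hy : y ∈ cut n) : x ∈ cut n := by
  obtain ⟨t, ht, hyt⟩ := hy
  exact ⟨t, ht, le.trans h hyt⟩

/-- The value `t` of the standard function `slowFun` at `n` is nonstandard, and
`n ≤ 2 ^ (n ^ (1 / t))`. -/
theorem self_mem_cut (hn : IsNonstandard n) : n ∈ cut n := by
  refine ⟨starF slowFun ![n], fun k hk => ?_, ?_⟩
  · obtain ⟨N, hN⟩ := eventually_le_slowFun (k + 1)
    have H := starR_of_forall (M := M) (R := fun v : Fin 1 → ℕ =>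
      N ≤ v 0 → slowFun ![v 0] = k → False) (fun v h₁ h₂ => by have := hN _ h₁; omega) ![n]
    simp only [starR_imp, starR_false, starR_le, starR_eq, starF_comp₁ slowFun, starF_proj,
      starF_const] at H
    exact H (hn.std_le N) hk
  · let E : (Fin 1 → ℕ) → ℕ := fun v => 2 ^ v 0
    have H := starR_of_forall (M := M) (R := fun v : Fin 1 → ℕ =>
      1 ≤ v 0 → v 0 ≤ E ![rootFun ![v 0, slowFun ![v 0] ] ])
      (fun v h => le_two_pow_rootFun_slowFun h) ![n]
    simp only [starR_imp, starR_le, starF_comp₁ slowFun, starF_comp₁ E, starF_comp₂ rootFun,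
      starF_proj, starF_const] at H
    exact H (hn.std_le 1)

theorem Outputs.eq_outFun {T ω y : M} (h : Outputs n T ω y) : y = starF outFun ![n, T, ω] := by
  have H := starR_of_forall (M := M) (R := fun v : Fin 4 → ℕ =>
    outRel ![v 0, v 1, v 2, v 3] → v 3 = outFun ![v 0, v 1, v 2])
    (fun v hv => (outFun_of_outRel hv).symm) ![n, T, ω, y]
  simp only [starR_imp, starR_eq, starR_comp₄ outRel, starF_comp₃ outFun, starF_proj] at H
  exact H h

theorem eq_outFun_of_mem_Fnb {α : Sample (samples n) → M} (hα : α ∈ Fnb n) :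
    ∃ T, IsNbTree n T ∧ ∀ ω, α ω = starF outFun ![n, T, ω.1] := by
  obtain ⟨T, hT, h⟩ := hα
  exact ⟨T, hT, fun ω => (h ω).eq_outFun⟩

theorem isInternal_of_mem_Fnb {α : Sample (samples n) → M} (hα : α ∈ Fnb n) : IsInternal α := by
  obtain ⟨T, -, h⟩ := eq_outFun_of_mem_Fnb hα
  have H := IsInternal.comp (S := samples n) (α := ![fun _ => n, fun _ => T, fun ω => ω.1])
    (fun i => by
      fin_cases i
      exacts [isInternal_const n, isInternal_const T, isInternal_sample]) outFun
  convert H using 1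
  funext ω
  rw [h]
  congr 1
  funext i
  fin_cases i <;> rfl

/-- The code of a tree with a single node. -/
def leafCode (v : Fin 1 → ℕ) : ℕ := 2 * v 0

/-- The constant random variables with values in `M_n` belong to `F_nb`. -/
theorem const_mem_Fnb (hn : IsNonstandard n) {c : M} (hc : c ∈ cut n) :
    (fun _ => c) ∈ Fnb n := by
  refine ⟨starF leafCode ![c], ⟨⟨n, hn, ?_⟩, fun m hm => ?_⟩, fun ω => ?_⟩
  · have H := starR_of_forall (M := M) (R := fun v : Fin 2 → ℕ =>
      depthRel ![v 0, leafCode ![v 1], rootFun ![v 0, v 0] ])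
      (fun v => ⟨.leaf (v 1), rfl, Nat.zero_le _⟩) ![n, c]
    simp only [starR_comp₃ depthRel, starF_comp₁ leafCode, starF_comp₂ rootFun, starF_proj] at H
    exact H
  · have H := starR_of_forall (M := M) (R := fun v : Fin 3 → ℕ =>
      leafRel ![v 0, leafCode ![v 1], v 2] → v 2 = v 1)
      (fun v ⟨T, hT, h⟩ => by
        obtain rfl : T = .leaf (v 1) := NbTree.code_injective hT
        exact h) ![n, c, m]
    simp only [starR_imp, starR_eq, starR_comp₃ leafRel, starF_comp₁ leafCode, starF_proj] at H
    have : m = c := H hm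
    exact this ▸ hc
  · have H := starR_of_forall (M := M) (R := fun v : Fin 3 → ℕ =>
      v 2 ∈ decodeSet (sampleCode ![v 0]) → outRel ![v 0, leafCode ![v 1], v 2, v 1])
      (fun v h => by
        obtain ⟨f, -, hf⟩ := mem_mapGraphs.1 h
        exact ⟨.leaf (v 1), f, rfl, hf, rfl⟩) ![n, c, ω.1]
    simp only [starR_imp, starR_mem, starR_comp₄ outRel, starF_comp₁ sampleCode,
      starF_comp₁ leafCode, starF_proj] at H
    exact H ω.2

/-- The value of the sampled map at a fixed point `i` is computed by a tree of depth `1`. -/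
theorem eval_mem_Fnb (hn : IsNonstandard n) {i : M} (hi : lt i n) :
    (fun ω => starF evalFun ![ω.1, i]) ∈ Fnb n := by
  refine ⟨starF askCode ![n, i], ⟨⟨n, hn, ?_⟩, fun m hm => ?_⟩, fun ω => ?_⟩
  · have H := starR_of_forall (M := M) (R := fun v : Fin 2 → ℕ =>
      v 1 < v 0 → depthRel ![v 0, askCode ![v 0, v 1], rootFun ![v 0, v 0] ])
      (fun v hv => by
        refine ⟨_, (askCode_of_lt hv).symm, le_trans ?_ (one_le_rootFun (by omega))⟩
        simp [NbTree.depth]) ![n, i]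
    simp only [starR_imp, starR_lt, starR_comp₃ depthRel, starF_comp₂ askCode,
      starF_comp₂ rootFun, starF_proj] at H
    exact H hi
  · have H := starR_of_forall (M := M) (R := fun v : Fin 3 → ℕ =>
      v 1 < v 0 → leafRel ![v 0, askCode ![v 0, v 1], v 2] → v 2 < v 0)
      (fun v hv ⟨T, hT, h⟩ => by
        obtain rfl := NbTree.code_injective (hT.trans (askCode_of_lt hv))
        obtain ⟨u, hu⟩ := Set.mem_iUnion.1 h
        exact hu.trans_lt u.2) ![n, i, m]
    simp only [starR_imp, starR_lt, starR_comp₃ leafRel, starF_comp₂ askCode, starF_proj] at H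
    exact mem_cut_of_le (lt.le (H hi hm)) (self_mem_cut hn)
  · have H := starR_of_forall (M := M) (R := fun v : Fin 3 → ℕ =>
      v 1 < v 0 → v 2 ∈ decodeSet (sampleCode ![v 0]) →
        outRel ![v 0, askCode ![v 0, v 1], v 2, evalFun ![v 2, v 1] ])
      (fun v hv h => by
        obtain ⟨f, -, hf⟩ := mem_mapGraphs.1 h
        refine ⟨_, f, (askCode_of_lt hv).symm, hf, ?_⟩
        have he := evalFun_graphCode f ⟨v 1, hv⟩
        rw [hf] at he
        exact he.symm) ![n, i, ω.1]
    simp only [starR_imp, starR_lt, starR_mem, starR_comp₄ outRel, starF_comp₁ sampleCode,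
      starF_comp₂ askCode, starF_comp₂ evalFun, starF_proj] at H
    exact H hi ω.2

/-! ### Two random variables are rarely a collision of the sampled map -/

theorem isNull_collision (hn : IsNonstandard n) {α β : Sample (samples n) → M} (hα : α ∈ Fnb n)
    (hβ : β ∈ Fnb n) :
    IsNull {ω : Sample (samples n) | lt (α ω) n ∧ lt (β ω) n ∧ α ω ≠ β ω ∧
      starF evalFun ![ω.1, α ω] = starF evalFun ![ω.1, β ω]} := by
  obtain ⟨T₁, ⟨⟨t₁, ht₁, hd₁⟩, -⟩, h₁⟩ := eq_outFun_of_mem_Fnb hα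
  obtain ⟨T₂, ⟨⟨t₂, ht₂, hd₂⟩, -⟩, h₂⟩ := eq_outFun_of_mem_Fnb hβ
  obtain rfl := funext h₁
  obtain rfl := funext h₂
  refine ⟨starF collisionCode ![n, T₁, T₂], fun x => ?_, fun K => ?_⟩
  · have H := starR_of_forall (M := M) (R := fun v : Fin 4 → ℕ =>
      v 3 ∈ decodeSet (collisionCode ![v 0, v 1, v 2]) ↔
        v 3 ∈ decodeSet (sampleCode ![v 0]) ∧
        outFun ![v 0, v 1, v 3] < v 0 ∧ outFun ![v 0, v 2, v 3] < v 0 ∧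
        ¬ outFun ![v 0, v 1, v 3] = outFun ![v 0, v 2, v 3] ∧
        evalFun ![v 3, outFun ![v 0, v 1, v 3] ] = evalFun ![v 3, outFun ![v 0, v 2, v 3] ])
      (fun v => mem_collisionCode) ![n, T₁, T₂, x]
    rw [starR_iff, starR_and, starR_and, starR_and, starR_and, starR_not] at H
    simp only [starR_mem, starR_lt, starR_eq, starF_comp₁ sampleCode,
      starF_comp₃ collisionCode, starF_comp₃ outFun,
      starF_comp₂ evalFun, starF_proj] at H
    exact H.trans ⟨fun ⟨hx, h⟩ => ⟨hx, h⟩, fun ⟨hx, h⟩ => ⟨hx, h⟩⟩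
  · have H := starR_of_forall (M := M) (R := fun v : Fin 5 → ℕ =>
      (100 * K + 100) ^ 2 ≤ v 0 → 4 ≤ v 3 → 4 ≤ v 4 →
      depthRel ![v 0, v 1, rootFun ![v 0, v 3] ] → depthRel ![v 0, v 2, rootFun ![v 0, v 4] ] →
      cardRel K 1 ![collisionCode ![v 0, v 1, v 2], sampleCode ![v 0] ])
      (fun v h₁ h₂ h₃ h₄ h₅ => by
        rw [cardRel, one_mul]
        exact mul_card_collisionCode_le h₁ h₂ h₃ h₄ h₅) ![n, T₁, T₂, t₁, t₂]
    simp only [starR_imp, starR_le, starR_comp₃ depthRel, starR_comp₂ (cardRel _ _),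
      starF_comp₃ collisionCode, starF_comp₂ rootFun, starF_comp₁ sampleCode, starF_proj,
      starF_const] at H
    exact starR_cardRel_one.1
      (H (hn.std_le _) (ht₁.std_le 4) (ht₂.std_le 4) hd₁ hd₂)

/-! ### The sampled map as a random function -/

/-- The partial function with domain `{0, …, n - 1}` whose graph is the sample. -/
noncomputable def sampledMap (hn : IsNonstandard n) : RandomFunction (samples n) n 1 where
  toFun ω x := open Classical in if lt (x 0) n then some (starF evalFun ![ω.1, x 0]) else none
  mem_cut ω x y h := by
    split_ifs at h with hx
    rw [Option.some_inj] at h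
    refine ⟨fun i => ?_, ?_⟩
    · rw [Subsingleton.elim i 0]
      exact mem_cut_of_le (lt.le hx) (self_mem_cut hn)
    · have H := starR_of_forall (M := M) (R := fun v : Fin 3 → ℕ =>
        v 1 < v 0 → v 2 ∈ decodeSet (sampleCode ![v 0]) → evalFun ![v 2, v 1] ≤ v 0)
        (fun v hv h => by
          obtain ⟨f, -, hf⟩ := mem_mapGraphs.1 h
          have he := evalFun_graphCode f ⟨v 1, hv⟩
          rw [hf] at he
          exact he.trans_le (f _).2.le) ![n, x 0, ω.1]
      simp only [starR_imp, starR_mem, starR_lt, starR_le, starF_comp₁ sampleCode,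
        starF_comp₂ evalFun, starF_proj] at H
      exact mem_cut_of_le (h ▸ H hx ω.2) (self_mem_cut hn)
  coded := by
    have H := isCoded_of_finite (M := M) (k := 3) (R := fun v : Fin 4 → ℕ =>
      v 1 ∈ decodeSet (sampleCode ![v 0]) ∧ v 2 < v 0 ∧ evalFun ![v 1, v 2] = v 3)
      (fun p => by
        refine ((((decodeSet (mapGraphs p)) ×ˢ Finset.range p).finite_toSet).image
          fun a => ![a.1, a.2, evalFun ![a.1, a.2] ]).subset ?_
        rintro x ⟨h₁, h₂, h₃⟩
        refine ⟨(x 0, x 1), by simpa using ⟨h₁, h₂⟩, ?_⟩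
        funext i
        fin_cases i
        exacts [rfl, rfl, h₃]) n
    simp only [starR_and, starR_mem, starR_lt, starR_eq, starF_comp₁ sampleCode,
      starF_comp₂ evalFun, starF_proj] at H
    refine (iff_of_eq (congrArg IsCoded (funext fun v => propext ?_))).1 H
    constructor
    · rintro ⟨h₁, h₂, h₃⟩
      exact ⟨h₁, (if_pos h₂).trans (congrArg some h₃)⟩
    · rintro ⟨h₁, h₂⟩
      split_ifs at h₂ with h₃
      exact ⟨h₁, h₃, Option.some_inj.1 h₂⟩

theorem sampledMap_toFun_of_lt (hn : IsNonstandard n) (ω : Sample (samples n)) {x : M}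
    (h : lt x n) : (sampledMap hn).toFun ω ![x] = some (starF evalFun ![ω.1, x]) := if_pos h

theorem sampledMap_toFun_of_not_lt (hn : IsNonstandard n) (ω : Sample (samples n)) {x : M}
    (h : ¬ lt x n) : (sampledMap hn).toFun ω ![x] = none := if_neg h

theorem sampledMap_apply (hn : IsNonstandard n) (ω : Sample (samples n)) (x : M) :
    (sampledMap hn).apply ω ![x] = starF applyFun ![n, ω.1, x] := by
  have H := starR_of_forall (M := M) (R := fun v : Fin 3 → ℕ =>
    (v 2 < v 0 → applyFun ![v 0, v 1, v 2] = evalFun ![v 1, v 2]) ∧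
    (¬ v 2 < v 0 → applyFun ![v 0, v 1, v 2] = 0))
    (fun v => ⟨fun h => if_pos h, fun h => if_neg h⟩) ![n, ω.1, x]
  rw [starR_and, starR_imp, starR_imp, starR_not] at H
  simp only [starR_lt, starR_eq, starF_comp₃ applyFun, starF_comp₂ evalFun, starF_proj,
    starF_const] at H
  by_cases h : lt x n
  · rw [RandomFunction.apply, sampledMap_toFun_of_lt hn ω h]
    exact (H.1 h).symm
  · rw [RandomFunction.apply, sampledMap_toFun_of_not_lt hn ω h]
    exact (H.2 h).symm

/-- The tuple witnessing membership in `G_nb` consists of the values at the points `i < n`. -/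
theorem sampledMap_mem_Gnb (hn : IsNonstandard n) : sampledMap hn ∈ Gnb n 1 := by
  refine ⟨n, fun i ω => starF evalFun ![ω.1, i], ?_, fun i hi => eval_mem_Fnb hn hi, ?_⟩
  · have H := isCoded_of_finite (M := M) (k := 3) (R := fun v : Fin 4 → ℕ =>
      v 1 < v 0 ∧ v 2 ∈ decodeSet (sampleCode ![v 0]) ∧ evalFun ![v 2, v 1] = v 3)
      (fun p => by
        refine ((((decodeSet (mapGraphs p)) ×ˢ Finset.range p).finite_toSet).image
          fun a => ![a.2, a.1, evalFun ![a.1, a.2] ]).subset ?_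
        rintro x ⟨h₁, h₂, h₃⟩
        refine ⟨(x 1, x 0), by simpa using ⟨h₂, h₁⟩, ?_⟩
        funext i
        fin_cases i
        exacts [rfl, rfl, h₃]) n
    simp only [starR_and, starR_mem, starR_lt, starR_eq, starF_comp₁ sampleCode,
      starF_comp₂ evalFun, starF_proj] at H
    refine (iff_of_eq (congrArg IsCoded (funext fun v => propext ?_))).1 H
    exact ⟨fun ⟨h₁, h₂, h₃⟩ => ⟨h₁, h₂, h₃⟩, fun ⟨h₁, h₂, h₃⟩ => ⟨h₁, h₂, h₃⟩⟩
  · intro α _ ω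
    by_cases h : lt (α ω) n
    · rw [RandomFunction.apply, sampledMap_toFun_of_lt hn ω h, if_pos h]
      rfl
    · rw [RandomFunction.apply, sampledMap_toFun_of_not_lt hn ω h, if_neg h]
      rfl

end Model

/-! ### Terms and atomic formulas -/

section Pigeon

variable {M : Type*} [LAll.Structure M] {n : M}

theorem eval_app {S : M} (e : Assignment S n) (X : ℕ) (t : Term₂ (Ln n)) :
    (Term₂.app (k := 1) X ![t]).eval e = fun ω => (e.set 1 X).apply ω ![t.eval e ω] := by
  funext ω
  refine congrArg ((e.set 1 X).apply ω) (funext fun i => ?_)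
  fin_cases i
  rfl

variable [M ⊨ LAll.completeTheory ℕ]

/-- The least `y` such that the set coded by `c` contains the triple `(ω, x, y)`, as a function of
`(c, ω, x)`. -/
noncomputable def lookupFun (v : Fin 3 → ℕ) : ℕ :=
  sInf {y | Encodable.encode ![v 1, v 2, y] ∈ decodeSet (v 0)}

/-- A random function is coded as a set of triples, in which its values are found by the standard
function `lookupFun`; both that function and `apply` return `0` where there is no value. -/
theorem RandomFunction.isInternal_apply {S : M} (Θ : RandomFunction S n 1) {α : Sample S → M}
    (hα : IsInternal α) : IsInternal fun ω => Θ.apply ω ![α ω] := by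
  obtain ⟨c, hc⟩ := Θ.coded
  have H := IsInternal.comp (S := S) (α := ![fun _ => c, fun ω => ω.1, α])
    (fun i => by
      fin_cases i
      exacts [isInternal_const c, isInternal_sample, hα]) lookupFun
  convert H using 1
  funext ω
  have e : (fun i => (![fun _ => c, fun ω => ω.1, α] : Fin 3 → Sample S → M) i ω) =
      ![c, ω.1, α ω] := by
    funext i
    fin_cases i <;> rfl
  rw [e]
  let E : (Fin 3 → ℕ) → ℕ := fun v => Encodable.encode v
  have hcE : ∀ y, Θ.toFun ω ![α ω] = some y ↔ mem (starF E ![ω.1, α ω, y]) c := by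
    intro y
    refine Iff.trans ?_ (hc ![ω.1, α ω, y])
    have e' : (fun i : Fin 1 => (![ω.1, α ω, y] : Fin 3 → M) i.succ.castSucc) = ![α ω] := by
      funext i
      fin_cases i
      rfl
    constructor
    · exact fun h => ⟨ω.2, (congrArg (Θ.toFun ω) e').trans h⟩
    · exact fun ⟨_, h⟩ => (congrArg (Θ.toFun ω) e').symm.trans h
  have H₁ := fun y => starR_of_forall (M := M) (R := fun v : Fin 4 → ℕ =>
    E ![v 1, v 2, v 3] ∈ decodeSet (v 0) →
      E ![v 1, v 2, lookupFun ![v 0, v 1, v 2] ] ∈ decodeSet (v 0))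
    (fun v h => Nat.sInf_mem (s := {y | E ![v 1, v 2, y] ∈ decodeSet (v 0)}) ⟨v 3, h⟩)
    ![c, ω.1, α ω, y]
  have H₂ := starR_of_forall (M := M) (R := fun v : Fin 3 → ℕ =>
    E ![v 1, v 2, lookupFun ![v 0, v 1, v 2] ] ∈ decodeSet (v 0) ∨ lookupFun ![v 0, v 1, v 2] = 0)
    (fun v => by
      rcases Set.eq_empty_or_nonempty {y | E ![v 1, v 2, y] ∈ decodeSet (v 0)} with h | h
      · exact Or.inr ((congrArg sInf h).trans Nat.sInf_empty)
      · exact Or.inl (Nat.sInf_mem h)) ![c, ω.1, α ω]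
  simp only [starR_imp, starR_or, starR_mem, starR_eq, starF_comp₃ E, starF_comp₃ lookupFun,
    starF_proj, starF_const] at H₁ H₂
  rw [RandomFunction.apply]
  rcases h : Θ.toFun ω ![α ω] with _ | y
  · rcases H₂ with h₂ | h₂
    · have h₃ := (hcE _).2 h₂
      rw [h] at h₃
      cases h₃
    · exact h₂.symm
  · have h₃ := (hcE _).2 (H₁ y ((hcE y).1 h))
    rw [h] at h₃
    exact Option.some_inj.1 h₃

/-- The bit length, as a standard function. -/
def sizeFun (v : Fin 1 → ℕ) : ℕ := Nat.size (v 0)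

/-- The truncated difference, as a standard function. -/
def subFun (v : Fin 2 → ℕ) : ℕ := v 0 - v 1

variable {S : M} {F : Set (Sample S → M)} {G : (k : ℕ) → Set (RandomFunction S n k)}

theorem eval_lenTerm (e : Assignment S n) (t : Term₂ (Ln n)) :
    (lenTerm t).eval e = fun ω => starF sizeFun ![t.eval e ω] := by
  funext ω
  refine congrArg (starF sizeFun) (funext fun i => ?_)
  fin_cases i
  rfl

theorem eval_subTerm (e : Assignment S n) (s t : Term₂ (Ln n)) :
    (subTerm s t).eval e = fun ω => starF subFun ![s.eval e ω, t.eval e ω] := by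
  funext ω
  refine congrArg (starF subFun) (funext fun i => ?_)
  fin_cases i <;> rfl

theorem eval_oneTerm (hn : IsNonstandard n) (e : Assignment S n) :
    (oneTerm hn).eval e = fun _ => std M 1 := by
  funext ω
  exact starF_const 1 _

theorem eval_zeroTerm (hn : IsNonstandard n) (e : Assignment S n) :
    (zeroTerm hn).eval e = fun _ => std M 0 := by
  funext ω
  exact starF_const 0 _

theorem isInternal_lenTerm {e : Assignment S n} {t : Term₂ (Ln n)} (h : IsInternal (t.eval e)) :
    IsInternal ((lenTerm t).eval e) :=
  IsInternal.comp (α := fun i => (![t] i).eval e) (fun i => by fin_cases i; exact h) sizeFun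

theorem isInternal_subTerm {e : Assignment S n} {s t : Term₂ (Ln n)} (hs : IsInternal (s.eval e))
    (ht : IsInternal (t.eval e)) : IsInternal ((subTerm s t).eval e) :=
  IsInternal.comp (α := fun i => (![s, t] i).eval e)
    (fun i => by fin_cases i; exacts [hs, ht]) subFun

theorem exists_hasValue_eq {e : Assignment S n} {s t : Term₂ (Ln n)} (hs : IsInternal (s.eval e))
    (ht : IsInternal (t.eval e)) :
    ∃ b, HasValue F G (.eq s t) e b ∧ IsClassOf (fun ω => s.eval e ω = t.eval e ω) b :=
  ⟨_, ⟨setOf_eq_mem_events hs ht, rfl⟩, ⟨setOf_eq_mem_events hs ht, rfl⟩⟩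

theorem exists_hasValue_rel₂ {e : Assignment S n} {s t : Term₂ (Ln n)} (R : (Fin 2 → ℕ) → Prop)
    (hs : IsInternal (s.eval e)) (ht : IsInternal (t.eval e)) :
    ∃ b, HasValue F G (.rel (L := Ln n) (k := 2) R ![s, t]) e b ∧
      IsClassOf (fun ω => starR R ![s.eval e ω, t.eval e ω]) b := by
  have h := setOf_starR_mem_events R (α := fun i => (![s, t] i).eval e)
    (fun i => by fin_cases i; exacts [hs, ht])
  refine ⟨_, ⟨h, rfl⟩, ?_⟩
  have e' : (fun ω => starR R ![s.eval e ω, t.eval e ω]) =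
      fun ω => starR R fun i => (![s, t] i).eval e ω := by
    funext ω
    refine congrArg (starR R) (funext fun i => ?_)
    fin_cases i <;> rfl
  rw [e']
  exact ⟨h, rfl⟩

theorem exists_hasValue_not {φ : Formula₂ (Ln n)} {e : Assignment S n} {P : Sample S → Prop}
    (h : ∃ b, HasValue F G φ e b ∧ IsClassOf P b) :
    ∃ b, HasValue F G (.not φ) e b ∧ IsClassOf (fun ω => ¬ P ω) b := by
  obtain ⟨b, hb, hP⟩ := h
  exact ⟨_, ⟨b, hb, rfl⟩, hP.not⟩

theorem exists_hasValue_and {φ ψ : Formula₂ (Ln n)} {e : Assignment S n} {P Q : Sample S → Prop}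
    (h : ∃ b, HasValue F G φ e b ∧ IsClassOf P b) (h' : ∃ b, HasValue F G ψ e b ∧ IsClassOf Q b) :
    ∃ b, HasValue F G (.and φ ψ) e b ∧ IsClassOf (fun ω => P ω ∧ Q ω) b := by
  obtain ⟨b, hb, hP⟩ := h
  obtain ⟨c, hc, hQ⟩ := h'
  exact ⟨_, ⟨b, c, hb, hc, rfl⟩, hP.and hQ⟩

theorem exists_hasValue_or {φ ψ : Formula₂ (Ln n)} {e : Assignment S n} {P Q : Sample S → Prop}
    (h : ∃ b, HasValue F G φ e b ∧ IsClassOf P b) (h' : ∃ b, HasValue F G ψ e b ∧ IsClassOf Q b) :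
    ∃ b, HasValue F G (.or φ ψ) e b ∧ IsClassOf (fun ω => P ω ∨ Q ω) b := by
  obtain ⟨b, hb, hP⟩ := h
  obtain ⟨c, hc, hQ⟩ := h'
  exact ⟨_, ⟨b, c, hb, hc, rfl⟩, hP.or hQ⟩

/-! ### Truth values of the weak pigeonhole principle -/

/-- The pointwise meaning of the formula `weakPigeon`: the values `x` and `y` at `ω` are a solution
of the instance given by `Θ_ω` and the value `m`. -/
def IsSolution (Θ : RandomFunction S n 1) (ω : Sample S) (m x y : M) : Prop :=
  m = std M 0 ∨
    ((lt (starF sizeFun ![x]) (starF sizeFun ![m]) ∧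
      lt (starF sizeFun ![y]) (starF sizeFun ![m])) ∧
    ((le (starF subFun ![starF sizeFun ![m], std M 1]) (starF sizeFun ![Θ.apply ω ![x] ]) ∨
      le (starF subFun ![starF sizeFun ![m], std M 1]) (starF sizeFun ![Θ.apply ω ![y] ])) ∨
      (¬ x = y ∧ Θ.apply ω ![x] = Θ.apply ω ![y])))

theorem starR_ge {x y : M} : starR (fun v : Fin 2 → ℕ => v 0 ≥ v 1) ![x, y] ↔ le y x := by
  have h := starR_le (M := M) (fun v : Fin 2 → ℕ => v 1) (fun v => v 0) ![x, y]
  rwa [starF_proj, starF_proj] at h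

theorem exists_hasValue_weakPigeon (hn : IsNonstandard n) {e : Assignment S n}
    (h₀ : IsInternal (e.num 0)) (h₁ : IsInternal (e.num 1)) (h₂ : IsInternal (e.num 2)) :
    ∃ b, HasValue F G (weakPigeon hn 0 0 1 2) e b ∧
      IsClassOf (fun ω => IsSolution (e.set 1 0) ω (e.num 0 ω) (e.num 1 ω) (e.num 2 ω)) b := by
  have hX : ∀ i, IsInternal (e.num i) →
      IsInternal ((Term₂.app (L := Ln n) (k := 1) 0 ![.var i]).eval e) := fun i hi => by
    rw [eval_app]
    exact (e.set 1 0).isInternal_apply hi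
  have hone : IsInternal ((oneTerm hn).eval e) := by
    rw [eval_oneTerm]
    exact isInternal_const _
  have hzero : IsInternal ((zeroTerm hn).eval e) := by
    rw [eval_zeroTerm]
    exact isInternal_const _
  have hv : ∀ i, IsInternal (e.num i) →
    IsInternal ((Term₂.var (L := Ln n) i).eval e) := fun i hi => hi
  have hlt := fun i (hi : IsInternal (e.num i)) => exists_hasValue_rel₂ (F := F) (G := G)
    (fun v => v 0 < v 1) (isInternal_lenTerm (hv i hi)) (isInternal_lenTerm (hv 0 h₀))
  have hge := fun i (hi : IsInternal (e.num i)) => exists_hasValue_rel₂ (F := F) (G := G)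
    (fun v => v 0 ≥ v 1) (isInternal_lenTerm (hX i hi))
    (isInternal_subTerm (isInternal_lenTerm (hv 0 h₀)) hone)
  have H := exists_hasValue_or (exists_hasValue_eq (F := F) (G := G) (hv 0 h₀) hzero)
    (exists_hasValue_and (exists_hasValue_and (hlt 1 h₁) (hlt 2 h₂))
      (exists_hasValue_or (exists_hasValue_or (hge 1 h₁) (hge 2 h₂))
        (exists_hasValue_and (exists_hasValue_not (exists_hasValue_eq (hv 1 h₁) (hv 2 h₂)))
          (exists_hasValue_eq (hX 1 h₁) (hX 2 h₂)))))
  obtain ⟨b, hb, hP⟩ := H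
  refine ⟨b, hb, ?_⟩
  simp only [starR_ge, eval_lenTerm, eval_subTerm, eval_app, eval_oneTerm, eval_zeroTerm] at hP
  exact hP

/-- If `Θ` is the sampled map and `m = n`, then a solution is a collision: `n` is a power of two,
so that `|x| < |n|` means `x < n`, and `|y| ≥ |n| - 1` means `y ≥ n / 2`. -/
theorem collision_of_isSolution (hn : IsNonstandard n)
    (hpow : ∃ k : M, n = starF (fun v : Fin 1 → ℕ => 2 ^ v 0) ![k]) {ω : Sample (samples n)}
    {x y : M} (h : IsSolution (sampledMap hn) ω n x y) :
    lt x n ∧ lt y n ∧ x ≠ y ∧ starF evalFun ![ω.1, x] = starF evalFun ![ω.1, y] := by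
  obtain ⟨k, hk⟩ := hpow
  let E : (Fin 1 → ℕ) → ℕ := fun v => 2 ^ v 0
  have hlt : ∀ z, lt (starF sizeFun ![z]) (starF sizeFun ![n]) → lt z n := by
    intro z
    have H := starR_of_forall (M := M) (R := fun v : Fin 3 → ℕ =>
      v 0 = E ![v 1] → sizeFun ![v 2] < sizeFun ![v 0] → v 2 < v 0) (fun v h₁ h₂ => by
        simp only [sizeFun, E, Matrix.cons_val] at h₁ h₂
        rw [h₁, Nat.size_pow, Nat.lt_succ_iff, Nat.size_le] at h₂
        rwa [h₁]) ![n, k, z]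
    simp only [starR_imp, starR_lt, starR_eq, starF_comp₁ sizeFun, starF_comp₁ E,
      starF_proj] at H
    exact H hk
  have hge : ∀ z, ¬ le (starF subFun ![starF sizeFun ![n], std M 1])
      (starF sizeFun ![starF applyFun ![n, ω.1, z] ]) := by
    intro z
    have H := starR_of_forall (M := M) (R := fun v : Fin 4 → ℕ =>
      v 0 = E ![v 1] → 2 ≤ v 0 → v 2 ∈ decodeSet (sampleCode ![v 0]) →
        subFun ![sizeFun ![v 0], 1] ≤ sizeFun ![applyFun ![v 0, v 2, v 3] ] → False)
      (fun v h₁ h₂ h₃ h₄ => by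
        obtain ⟨f, hf, hω⟩ := mem_mapGraphs.1 h₃
        simp only [sizeFun, subFun, E, Matrix.cons_val] at h₁ hf h₄
        obtain ⟨j, hj⟩ : ∃ j, v 1 = j + 1 := Nat.exists_eq_succ_of_ne_zero (by
          intro h0
          rw [h0, pow_zero] at h₁
          omega)
        have hhalf : v 0 / 2 = 2 ^ j := by
          rw [h₁, hj, pow_succ, Nat.mul_div_cancel _ two_pos]
        have hz : applyFun ![v 0, v 2, v 3] < 2 ^ j := by
          by_cases hz : v 3 < v 0
          · have he := evalFun_graphCode f ⟨v 3, hz⟩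
            rw [hω] at he
            rw [show applyFun ![v 0, v 2, v 3] = evalFun ![v 2, v 3] from if_pos hz]
            exact he.trans_lt (hhalf ▸ hf _)
          · rw [show applyFun ![v 0, v 2, v 3] = 0 from if_neg hz]
            positivity
        have h₅ := Nat.size_le.2 hz
        have h₆ : Nat.size (v 0) = v 1 + 1 := by rw [h₁, Nat.size_pow]
        omega) ![n, k, ω.1, z]
    simp only [starR_imp, starR_false, starR_mem, starR_le, starR_eq, starF_comp₁ sizeFun,
      starF_comp₂ subFun, starF_comp₃ applyFun, starF_comp₁ sampleCode, starF_comp₁ E,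
      starF_proj, starF_const] at H
    exact H hk (hn.std_le 2) ω.2
  have happ : ∀ z, lt z n → starF applyFun ![n, ω.1, z] = starF evalFun ![ω.1, z] := by
    intro z
    have H := starR_of_forall (M := M) (R := fun v : Fin 3 → ℕ =>
      v 2 < v 0 → applyFun ![v 0, v 1, v 2] = evalFun ![v 1, v 2])
      (fun v h => if_pos h) ![n, ω.1, z]
    simp only [starR_imp, starR_lt, starR_eq, starF_comp₃ applyFun, starF_comp₂ evalFun,
      starF_proj] at H
    exact H
  simp only [IsSolution, sampledMap_apply] at h
  rcases h with h | ⟨⟨hx, hy⟩, (h | h) | ⟨hxy, h⟩⟩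
  · exact absurd h (hn 0)
  · exact absurd h (hge x)
  · exact absurd h (hge y)
  · rw [happ x (hlt x hx), happ y (hlt y hy)] at h
    exact ⟨hlt x hx, hlt y hy, hxy, h⟩

/-- On vertices, the sampled map is the edge relation of the sample. -/
theorem sampledMap_apply_eq_iff_edge (hn : IsNonstandard n) (ω : Sample (samples n)) {x y : M}
    (hx : lt x n) : (sampledMap hn).apply ω ![x] = y ↔ Edge ω.1 x y := by
  rw [sampledMap_apply]
  let P : (Fin 2 → ℕ) → ℕ := fun v => Nat.pair (v 0) (v 1)
  have H := starR_of_forall (M := M) (R := fun v : Fin 4 → ℕ =>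
    v 2 < v 0 → v 1 ∈ decodeSet (sampleCode ![v 0]) →
      (applyFun ![v 0, v 1, v 2] = v 3 ↔ P ![v 2, v 3] ∈ decodeSet (v 1)))
    (fun v h₁ h₂ => by
      obtain ⟨f, -, hf⟩ := mem_mapGraphs.1 h₂
      have he := evalFun_graphCode f ⟨v 2, h₁⟩
      rw [show applyFun ![v 0, v 1, v 2] = evalFun ![v 1, v 2] from if_pos h₁, ← hf]
      refine Iff.trans (iff_of_eq (congrArg (· = v 3) he)) ?_
      exact Iff.trans ⟨fun h => ⟨h₁, h⟩, fun ⟨_, h⟩ => h⟩ pair_mem_graphCode.symm)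
    ![n, ω.1, x, y]
  simp only [starR_imp, starR_iff, starR_lt, starR_eq, starR_mem, starF_comp₁ sampleCode,
    starF_comp₃ applyFun, starF_comp₂ P, starF_proj] at H
  exact H hx ω.2

end Pigeon

end WideLimit

open WideLimit in
theorem theorem6p5 {M : Type*} [LAll.Structure M] [M ⊨ LAll.completeTheory ℕ]
    (hsat : IsAlephOneSaturated M) (n : M) (hn : IsNonstandard n)
    (hpow : ∃ k : M, n = starF (fun v : Fin 1 → ℕ => 2 ^ v 0) ![k]) :
    (∀ e : Assignment (samples n) n, HasValue (Fnb n) (Gnb n) (weakPigeonTotal hn) e ⊥) ∧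
    ∃ Θ ∈ Gnb n 1,
      (∀ α ∈ vertices n (Fnb n), ∀ β ∈ vertices n (Fnb n), ∀ e : Assignment (samples n) n,
        ∃ b : TruthValue (samples n),
          HasValue (Fnb n) (Gnb n) (.eq (.app 0 ![.var 0]) (.var 1))
            (((e.setSet 0 Θ).setNum 0 α).setNum 1 β) b ∧
          IsClassOf (fun ω => Edge ω.1 (α ω) (β ω)) b) ∧
      ∃ ν ∈ Fnb n, (∀ ω, ν ω = n) ∧
        ∀ e : Assignment (samples n) n,
          HasValue (Fnb n) (Gnb n) (.exNum 1 (.exNum 2 (weakPigeon hn 0 0 1 2)))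
            ((e.setSet 0 Θ).setNum 0 ν) ⊥ := by
  have hset : ∀ (e : Assignment (samples n) n) Θ (μ α β : Sample (samples n) → M),
      ((((e.setSet 0 Θ).setNum 0 μ).setNum 1 α).setNum 2 β).set 1 0 = Θ := by
    intro e Θ μ α β
    simp [Assignment.setSet, Assignment.setNum]
  -- the truth value of the matrix exists for all values of the variables
  have hmatrix : ∀ (e : Assignment (samples n) n) (Θ : RandomFunction (samples n) n 1),
      ∀ μ ∈ Fnb n, ∀ α ∈ Fnb n, ∀ β ∈ Fnb n, ∃ b,
        HasValue (Fnb n) (Gnb n) (weakPigeon hn 0 0 1 2)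
          ((((e.setSet 0 Θ).setNum 0 μ).setNum 1 α).setNum 2 β) b ∧
        IsClassOf (fun ω => IsSolution Θ ω (μ ω) (α ω) (β ω)) b := by
    intro e Θ μ hμ α hα β hβ
    obtain ⟨b, hb, hP⟩ := exists_hasValue_weakPigeon (F := Fnb n) (G := Gnb n) hn
      (e := (((e.setSet 0 Θ).setNum 0 μ).setNum 1 α).setNum 2 β)
      (isInternal_of_mem_Fnb hμ) (isInternal_of_mem_Fnb hα) (isInternal_of_mem_Fnb hβ)
    rw [hset] at hP
    exact ⟨b, hb, hP⟩
  have hbot : ∀ {ι : Type _} {v : ι → TruthValue (samples n)}, (∀ i, v i = ⊥) →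
      IsLUB (Set.range v) ⊥ := by
    intro ι v hv
    refine ⟨?_, fun _ _ => bot_le⟩
    rintro _ ⟨i, rfl⟩
    exact (hv i).le
  have hν : (fun _ => n) ∈ Fnb n := const_mem_Fnb hn (self_mem_cut hn)
  have hexists : ∀ e : Assignment (samples n) n,
      HasValue (Fnb n) (Gnb n) (.exNum 1 (.exNum 2 (weakPigeon hn 0 0 1 2)))
        ((e.setSet 0 (sampledMap hn)).setNum 0 fun _ => n) ⊥ := by
    intro e
    refine ⟨fun _ => ⊥, fun α => ?_, hbot fun _ => rfl⟩
    refine ⟨fun _ => ⊥, fun β => ?_, hbot fun _ => rfl⟩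
    obtain ⟨b, hb, hP⟩ := hmatrix e (sampledMap hn) _ hν α.1 α.2 β.1 β.2
    have hb0 : b = ⊥ := hP.eq_bot (isNull_mono hP.choose
      (fun ω hω => collision_of_isSolution hn hpow hω) (isNull_collision hn α.2 β.2))
    exact hb0 ▸ hb
  have hexists' : ∀ (e : Assignment (samples n) n) (Θ : RandomFunction (samples n) n 1),
      ∀ μ ∈ Fnb n, ∃ b,
        HasValue (Fnb n) (Gnb n) (.exNum 1 (.exNum 2 (weakPigeon hn 0 0 1 2)))
          ((e.setSet 0 Θ).setNum 0 μ) b := by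
    intro e Θ μ hμ
    have h₁ : ∀ α : Fnb n, ∃ b, HasValue (Fnb n) (Gnb n) (.exNum 2 (weakPigeon hn 0 0 1 2))
        (((e.setSet 0 Θ).setNum 0 μ).setNum 1 α) b := by
      intro α
      choose v hv _ using fun β : Fnb n => hmatrix e Θ μ hμ α.1 α.2 β.1 β.2
      obtain ⟨b, hb⟩ := hsat.exists_isLUB (Set.range v)
      exact ⟨b, v, hv, hb⟩
    choose v hv using h₁
    obtain ⟨b, hb⟩ := hsat.exists_isLUB (Set.range v)
    exact ⟨b, v, hv, hb⟩
  refine ⟨fun e => ?_, sampledMap hn, sampledMap_mem_Gnb hn, fun α hα β hβ e => ?_,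
    fun _ => n, hν, fun _ => rfl, hexists⟩
  · -- the infimum over `m` exists for every `Θ`, and is `⊥` for the sampled map
    have h₁ : ∀ Θ : Gnb n 1, ∃ b, HasValue (Fnb n) (Gnb n)
        (.allNum 0 (.exNum 1 (.exNum 2 (weakPigeon hn 0 0 1 2)))) (e.setSet 0 Θ.1) b ∧
        (Θ.1 = sampledMap hn → b = ⊥) := by
      intro Θ
      by_cases hΘ : Θ.1 = sampledMap hn
      · choose v hv using fun μ : Fnb n => hexists' e Θ.1 μ.1 μ.2
        classical
        let w : Fnb n → TruthValue (samples n) := fun μ => if μ.1 = (fun _ => n) then ⊥ else v μ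
        refine ⟨⊥, ⟨w, fun μ => ?_, fun b _ => ?_, fun b hb => ?_⟩, fun _ => rfl⟩
        · by_cases hμ : μ.1 = fun _ => n
          · simp only [w, if_pos hμ, hμ, hΘ]
            exact hexists e
          · simp only [w, if_neg hμ]
            exact hv μ
        · exact bot_le
        · exact hb ⟨⟨_, hν⟩, if_pos rfl⟩
      · choose v hv using fun μ : Fnb n => hexists' e Θ.1 μ.1 μ.2
        obtain ⟨b, hb⟩ := hsat.exists_isGLB (Set.range v)
        exact ⟨b, ⟨v, hv, hb⟩, fun h => absurd h hΘ⟩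
    choose v hv hv0 using h₁
    refine ⟨v, hv, ?_, fun b hb => ?_⟩
    · rintro _ ⟨Θ, rfl⟩
      exact bot_le
    · exact (hb ⟨⟨_, sampledMap_mem_Gnb hn⟩, rfl⟩).trans (hv0 _ rfl).le
  · obtain ⟨b, hb, hP⟩ := exists_hasValue_eq (F := Fnb n) (G := Gnb n)
      (e := ((e.setSet 0 (sampledMap hn)).setNum 0 α).setNum 1 β)
      (s := .app 0 ![.var 0]) (t := .var 1) (by
        rw [eval_app]
        exact RandomFunction.isInternal_apply _ (isInternal_of_mem_Fnb hα.1))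
      (isInternal_of_mem_Fnb hβ.1)
    refine ⟨b, hb, ?_⟩
    have e' : (fun ω => Edge ω.1 (α ω) (β ω)) =
        fun ω => (sampledMap hn).apply ω ![α ω] = β ω := by
      funext ω
      exact propext (sampledMap_apply_eq_iff_edge hn ω (hα.2 ω)).symm
    rw [e']
    rw [eval_app] at hP
    simpa [Assignment.setSet, Assignment.setNum, Term₂.eval] using hP
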